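/- For a group $H$ let $\gamma_1(H)=H$, $\gamma_{n+1}(H)=[\gamma_n(H),H]$ be its lower central series, and let $D_n(H)=\{g\in H : g-1\in \mathfrak h^n\}$ be its dimension subgroups, where $\mathfrak h$ is the augmentation ideal of $\mathbb Z[H]$. For a group $G$ let $\mathsf{Pres}(G)$ be the category whose objects are the free presentations of $G$, i.e. epimorphisms $\pi\colon F\twoheadrightarrow G$ from free groups $F$ (with $R=\ker\pi$), and whose morphisms are the group homomorphisms over $G$. Both $\frac{R\cap\gamma_2(F)}{\gamma_2(R)(R\cap\gamma_4(F))}$ and $\frac{\gamma_2(F)}{\gamma_2(R)\gamma_4(F)}$ are functors from $\mathsf{Pres}(G)$ to abelian groups, and their limits $\varprojlim$ over $\mathsf{Pres}(G)$ are functors of $G$: for a homomorphism $h\colon G\to G'$, the induced map of limits is the one compatible with all maps induced by homomorphisms $F\to F'$ over $h$, for $F\twoheadrightarrow G$ in $\mathsf{Pres}(G)$ and $F'\twoheadrightarrow G'$ in $\mathsf{Pres}(G')$. **Theorem.** There is a short exact sequence of abelian groups, natural in the group $G$, $$ \varprojlim \frac{R\cap \gamma_2(F)}{\gamma_2(R)(R\cap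 \gamma_4(F))}\hookrightarrow \varprojlim \frac{\gamma_2(F)}{\gamma_2(R)\gamma_4(F)}\twoheadrightarrow \frac{D_4(G)}{\gamma_4(G)}. $$ Here the first map is induced by the inclusions $R\cap\gamma_2(F)\subseteq\gamma_2(F)$, and the second map is induced by the projections $\pi\colon F\to G$: if the component of $x$ at a presentation $\pi\colon F\twoheadrightarrow G$ is the class of $w\in\gamma_2(F)$, then $\pi(w)\in D_4(G)$ and $x$ is sent to the class of $\pi(w)$. -/

import Mathlib

open CategoryTheory CategoryTheory.Limits

universe u

namespace PresLim

/-! ### Lower central series and dimension subgroups -/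

/-- `γ n H` is the `n`-th term of the lower central series of the group `H`, for `n ≥ 1`, with
the convention `γ 1 H = H`, `γ (n + 1) H = [γ n H, H]` (Mathlib numbers the terms from `0`). -/
def γ (n : ℕ) (H : Type*) [Group H] : Subgroup H :=
  (⊤ : Subgroup H).lowerCentralSeries (n - 1)

instance γ_normal (n : ℕ) (H : Type*) [Group H] : (γ n H).Normal := by
  unfold γ; infer_instance

/-- The augmentation ideal of the integral group ring `ℤ[H]`. -/
noncomputable def augIdeal (H : Type*) [Group H] : Ideal (MonoidAlgebra ℤ H) :=
  RingHom.ker (MonoidAlgebra.lift ℤ ℤ H (1 : H →* ℤ))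

/-- The `n`-th dimension subgroup `D_n(H) = H ∩ (1 + 𝔥ⁿ)`, `𝔥` the augmentation ideal of `ℤ[H]`. -/
noncomputable def D (n : ℕ) (H : Type*) [Group H] : Subgroup H where
  carrier := {g | MonoidAlgebra.of ℤ H g - 1 ∈ augIdeal H ^ n}
  one_mem' := by
    change MonoidAlgebra.of ℤ H 1 - 1 ∈ augIdeal H ^ n
    rw [map_one, sub_self]; exact Ideal.zero_mem _
  mul_mem' {a b} ha hb := by
    have h : MonoidAlgebra.of ℤ H (a * b) - 1 = MonoidAlgebra.of ℤ H a *
        (MonoidAlgebra.of ℤ H b - 1) + (MonoidAlgebra.of ℤ H a - 1) := by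
      rw [map_mul]; noncomm_ring
    change MonoidAlgebra.of ℤ H (a * b) - 1 ∈ augIdeal H ^ n
    rw [h]
    exact Ideal.add_mem _ (Ideal.mul_mem_left _ _ hb) ha
  inv_mem' {a} ha := by
    have h : MonoidAlgebra.of ℤ H a⁻¹ - 1 = -(MonoidAlgebra.of ℤ H a⁻¹ *
        (MonoidAlgebra.of ℤ H a - 1)) := by
      rw [mul_sub, ← map_mul, inv_mul_cancel, map_one, mul_one, neg_sub]
    change MonoidAlgebra.of ℤ H a⁻¹ - 1 ∈ augIdeal H ^ n
    rw [h]
    exact (Ideal.neg_mem_iff _).2 (Ideal.mul_mem_left _ _ ha)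

theorem mem_D {n : ℕ} {H : Type*} [Group H] {g : H} :
    g ∈ D n H ↔ MonoidAlgebra.of ℤ H g - 1 ∈ augIdeal H ^ n := Iff.rfl

theorem map_γ_le (n : ℕ) {H K : Type*} [Group H] [Group K] (f : H →* K) :
    γ n H ≤ (γ n K).comap f := by
  rw [← Subgroup.map_le_iff_le_comap]
  unfold γ
  generalize n - 1 = m
  induction m with
  | zero => simp
  | succ m ih =>
    rw [Subgroup.lowerCentralSeries_succ, Subgroup.lowerCentralSeries_succ,
      Subgroup.map_commutator]
    exact Subgroup.commutator_mono ih le_top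

/-- `[γ₂(H), γ₂(H)] ⊆ γ₄(H)`. -/
theorem commutator_γ_two (H : Type*) [Group H] : ⁅γ 2 H, γ 2 H⁆ ≤ γ 4 H := by
  have e : ∀ K : Subgroup H, K ≤ γ 4 H ↔ K.map (QuotientGroup.mk' (γ 4 H)) = ⊥ := by
    intro K
    rw [Subgroup.map_eq_bot_iff, QuotientGroup.ker_mk']
  have h4 : ⁅⁅γ 2 H, (⊤ : Subgroup H)⁆, (⊤ : Subgroup H)⁆ ≤ γ 4 H := le_rfl
  have h4' : ⁅⁅(⊤ : Subgroup H), γ 2 H⁆, (⊤ : Subgroup H)⁆ ≤ γ 4 H := by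
    rw [Subgroup.commutator_comm ⊤ (γ 2 H)]; exact h4
  have h2 : γ 2 H = ⁅(⊤ : Subgroup H), (⊤ : Subgroup H)⁆ := rfl
  have : ⁅⁅(⊤ : Subgroup H), (⊤ : Subgroup H)⁆, γ 2 H⁆ ≤ γ 4 H := by
    rw [e] at h4 h4' ⊢
    simp only [Subgroup.map_commutator] at h4 h4' ⊢
    exact Subgroup.commutator_commutator_eq_bot_of_rotate h4' h4
  rwa [← h2] at this

theorem map_augIdeal_pow (n : ℕ) {H K : Type*} [Group H] [Group K] (f : H →* K)
    (x : MonoidAlgebra ℤ H) (hx : x ∈ augIdeal H ^ n) :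
    MonoidAlgebra.mapDomainRingHom ℤ f x ∈ augIdeal K ^ n := by
  have h1 : ∀ y : MonoidAlgebra ℤ H, y ∈ augIdeal H →
      MonoidAlgebra.mapDomainRingHom ℤ f y ∈ augIdeal K := by
    intro y hy
    have : ((MonoidAlgebra.lift ℤ ℤ K (1 : K →* ℤ) : MonoidAlgebra ℤ K →+* ℤ).comp
        (MonoidAlgebra.mapDomainRingHom ℤ f)) =
        (MonoidAlgebra.lift ℤ ℤ H (1 : H →* ℤ) : MonoidAlgebra ℤ H →+* ℤ) := by
      ext <;> simp
    have h := RingHom.congr_fun this y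
    simp only [augIdeal, RingHom.mem_ker] at hy ⊢
    exact h.trans hy
  induction n generalizing x with
  | zero =>
    rw [Submodule.pow_zero, Ideal.one_eq_top]; trivial
  | succ n ih =>
    rw [Submodule.pow_succ] at hx ⊢
    refine Submodule.smul_induction_on hx ?_ ?_
    · intro a ha b hb
      rw [smul_eq_mul, map_mul]
      exact Ideal.mul_mem_mul (ih a ha) (h1 b hb)
    · intro a b ha hb
      rw [map_add]
      exact Ideal.add_mem _ ha hb

theorem map_D_le (n : ℕ) {H K : Type*} [Group H] [Group K] (f : H →* K) :
    D n H ≤ (D n K).comap f := by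
  intro g hg
  have := map_augIdeal_pow n f _ (mem_D.1 hg)
  rw [Subgroup.mem_comap, mem_D]
  rw [map_sub, map_one] at this
  simpa [MonoidAlgebra.of_apply] using this

/-- `D₂(H) ⊆ γ₂(H)`. -/
theorem D_two_le (H : Type*) [Group H] : D 2 H ≤ γ 2 H := by
  let φ : MonoidAlgebra ℤ H →ₗ[ℤ] Additive (Abelianization H) :=
    (Finsupp.lift (Additive (Abelianization H)) ℤ H fun h => Additive.ofMul (Abelianization.of h)) ∘ₗ
      (MonoidAlgebra.coeffLinearEquiv ℤ).toLinearMap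
  have hφ : ∀ h : H, φ (MonoidAlgebra.of ℤ H h) = Additive.ofMul (Abelianization.of h) := by
    intro h
    simp [φ]
  let ε := MonoidAlgebra.lift ℤ ℤ H (1 : H →* ℤ)
  have hε : ∀ h : H, ε (MonoidAlgebra.of ℤ H h) = 1 := by
    intro h
    simp [ε]
  have key : ∀ a b : MonoidAlgebra ℤ H, φ (a * b) = ε a • φ b + ε b • φ a := by
    intro a b
    induction a using MonoidAlgebra.induction_on with
    | of g =>
      induction b using MonoidAlgebra.induction_on with
      | of h =>
        rw [← map_mul, hφ, hφ, hφ, hε, hε, map_mul, ofMul_mul, one_smul, one_smul, add_comm]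
      | add x y hx hy =>
        rw [mul_add, map_add, hx, hy, map_add, map_add, smul_add, add_smul]; abel
      | smul r x hx =>
        rw [mul_smul_comm, map_smul, hx, map_smul, map_smul, smul_add, smul_comm r, smul_assoc]
    | add x y hx hy =>
      rw [add_mul, map_add, hx, hy, map_add, map_add, smul_add, add_smul]; abel
    | smul r x hx =>
      rw [smul_mul_assoc, map_smul, hx, map_smul, map_smul, smul_add, smul_comm r (ε b), smul_assoc]
  have hz : ∀ x ∈ augIdeal H ^ 2, φ x = 0 := by
    intro x hx
    rw [Submodule.pow_succ, Submodule.pow_one] at hx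
    refine Submodule.smul_induction_on hx ?_ ?_
    · intro a ha b hb
      have ha' : ε a = 0 := ha
      have hb' : ε b = 0 := hb
      rw [smul_eq_mul, key, ha', hb', zero_smul, zero_smul, add_zero]
    · intro a b ha hb
      rw [map_add, ha, hb, add_zero]
  intro g hg
  have h := hz _ (mem_D.1 hg)
  rw [map_sub, ← map_one (MonoidAlgebra.of ℤ H), hφ, hφ, map_one, ofMul_one, sub_zero] at h
  have h' : Abelianization.of g = 1 := h
  have h'' : g ∈ (Abelianization.of (G := H)).ker := h'
  rw [Abelianization.ker_of] at h''
  exact h''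

theorem D_antitone (H : Type*) [Group H] : Antitone fun n => D n H :=
  fun _ _ h _ hg => Ideal.pow_le_pow_right h hg

/-! ### Abelian subquotients of a group -/

/-- For subgroups `A, N` of `E` with `N` normal and `[A, A] ⊆ N`, the group `A / (A ∩ N)` is
abelian (it is `A / N` when `N ⊆ A`). -/
@[reducible] def subquotCommGroup {E : Type u} [Group E] (A N : Subgroup E) [N.Normal]
    (h : ⁅A, A⁆ ≤ N) : CommGroup (A ⧸ N.subgroupOf A) :=
  { (inferInstance : Group (A ⧸ N.subgroupOf A)) with
    mul_comm := by
      intro a b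
      induction a using QuotientGroup.induction_on with | _ a
      induction b using QuotientGroup.induction_on with | _ b
      refine QuotientGroup.eq.2 ?_
      rw [Subgroup.mem_subgroupOf]
      have := h (Subgroup.commutator_mem_commutator (b⁻¹).2 (a⁻¹).2)
      simpa [commutatorElement_def, mul_assoc] using this }

/-- The abelian group `A / (A ∩ N)`, written additively, as an object of the category of
abelian groups. -/
abbrev subquot {E : Type u} [Group E] (A N : Subgroup E) [N.Normal] (h : ⁅A, A⁆ ≤ N) :
    AddCommGrpCat.{u} :=
  letI := subquotCommGroup A N h
  AddCommGrpCat.of (Additive (A ⧸ N.subgroupOf A))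

/-- The class of `a ∈ A` in the abelian group `A / (A ∩ N)`. -/
def subquotMk {E : Type u} [Group E] (A N : Subgroup E) [N.Normal] (h : ⁅A, A⁆ ≤ N) (a : A) :
    subquot A N h :=
  Additive.ofMul (QuotientGroup.mk a : A ⧸ N.subgroupOf A)

/-- The homomorphism `A / (A ∩ N) → A' / (A' ∩ N')`, `[a] ↦ [f a]`, induced by a homomorphism
`f : E → E'` with `f(A) ⊆ A'` and `f(N) ⊆ N'`. -/
def subquotMap {E E' : Type u} [Group E] [Group E'] {A N : Subgroup E} [N.Normal]
    {A' N' : Subgroup E'} [N'.Normal] (h : ⁅A, A⁆ ≤ N) (h' : ⁅A', A'⁆ ≤ N') (f : E →* E')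
    (hA : A ≤ A'.comap f) (hN : N ≤ N'.comap f) : subquot A N h ⟶ subquot A' N' h' :=
  letI := subquotCommGroup A N h
  letI := subquotCommGroup A' N' h'
  AddCommGrpCat.ofHom (MonoidHom.toAdditive
    (QuotientGroup.map (N.subgroupOf A) (N'.subgroupOf A')
      ((f.comp A.subtype).codRestrict A' fun a => hA a.2) fun _ ha => hN ha) :
        Additive (A ⧸ N.subgroupOf A) →+ Additive (A' ⧸ N'.subgroupOf A'))

theorem subquotMap_mk {E E' : Type u} [Group E] [Group E'] {A N : Subgroup E} [N.Normal]
    {A' N' : Subgroup E'} [N'.Normal] (h : ⁅A, A⁆ ≤ N) (h' : ⁅A', A'⁆ ≤ N') (f : E →* E')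
    (hA : A ≤ A'.comap f) (hN : N ≤ N'.comap f) (a : A) :
    subquotMap h h' f hA hN (subquotMk A N h a) = subquotMk A' N' h' ⟨f a, hA a.2⟩ :=
  rfl

theorem subquotMk_surjective {E : Type u} [Group E] (A N : Subgroup E) [N.Normal]
    (h : ⁅A, A⁆ ≤ N) : Function.Surjective (subquotMk A N h) :=
  fun x => QuotientGroup.mk_surjective (s := N.subgroupOf A) x

theorem subquot_hom_ext {E : Type u} [Group E] {A N : Subgroup E} [N.Normal] {h : ⁅A, A⁆ ≤ N}
    {X : AddCommGrpCat.{u}} {f g : subquot A N h ⟶ X}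
    (w : ∀ a, f (subquotMk A N h a) = g (subquotMk A N h a)) : f = g := by
  ext x
  obtain ⟨a, rfl⟩ := subquotMk_surjective A N h x
  exact w a

/-! ### The category of free presentations of a group -/

/-- A free presentation of `G`: a free group `F` with an epimorphism `π : F → G`. -/
structure Pres (G : Type u) [Group G] where
  F : Type u
  [group : Group F]
  [free : IsFreeGroup F]
  π : F →* G
  surj : Function.Surjective π

attribute [instance] Pres.group Pres.free

/-- The subgroup of relations `R = ker (F → G)`. -/
def Pres.R {G : Type u} [Group G] (c : Pres G) : Subgroup c.F := c.π.ker

instance Pres.R_normal {G : Type u} [Group G] (c : Pres G) : c.R.Normal := by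
  unfold Pres.R; infer_instance

/-- A morphism of free presentations of `G`: a homomorphism `F → F'` over `G`. -/
@[ext]
structure Pres.Hom {G : Type u} [Group G] (c c' : Pres G) where
  hom : c.F →* c'.F
  comm : c'.π.comp hom = c.π

/-- The category `Pres(G)`. -/
instance Pres.category {G : Type u} [Group G] : Category.{u} (Pres G) where
  Hom c c' := Pres.Hom c c'
  id c := ⟨MonoidHom.id _, rfl⟩
  comp f g := ⟨g.hom.comp f.hom, by rw [← MonoidHom.comp_assoc, g.comm, f.comm]⟩

/-- A free presentation `R ↪ F ↠ G` of some (varying) group `G`. -/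
structure AllPres : Type (u + 1) where
  G : GrpCat.{u}
  pres : Pres G

/-- A morphism from `F ↠ G` to `F' ↠ G'`: a commutative square of homomorphisms. -/
@[ext]
structure AllPres.Hom (c c' : AllPres.{u}) where
  base : c.G →* c'.G
  hom : c.pres.F →* c'.pres.F
  comm : c'.pres.π.comp hom = base.comp c.pres.π

/-- The category of free presentations of all groups. -/
instance AllPres.category : Category.{u} AllPres.{u} where
  Hom c c' := AllPres.Hom c c'
  id c := ⟨MonoidHom.id _, MonoidHom.id _, rfl⟩
  comp f g := ⟨g.base.comp f.base, g.hom.comp f.hom, by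
    rw [← MonoidHom.comp_assoc, g.comm, MonoidHom.comp_assoc, f.comm, MonoidHom.comp_assoc]⟩

/-- The (non-full) inclusion of `Pres(G)` in the category of all free presentations. -/
abbrev fiber (G : GrpCat.{u}) : Pres G ⥤ AllPres.{u} where
  obj c := ⟨G, c⟩
  map f := AllPres.Hom.mk (MonoidHom.id _) f.hom f.comm

/-! ### Limits over `Pres(G)`, and their functoriality in `G` -/

/-- The free presentation of `G` on the set `G × S`, with `(g, s) ↦ g`. -/
def stdPres (G : Type u) [Group G] (S : Type u) [Nonempty S] : Pres G where
  F := FreeGroup (G × S)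
  π := FreeGroup.lift Prod.fst
  surj g := ⟨FreeGroup.of (g, Classical.arbitrary S), by simp⟩

/-- A morphism from a standard presentation to an arbitrary one, over a given homomorphism,
prescribed on the generators. -/
def stdHom {G : GrpCat.{u}} (S : Type u) [Nonempty S] (c' : AllPres.{u}) (h : G →* c'.G)
    (t : G × S → c'.pres.F) (ht : ∀ x, c'.pres.π (t x) = h x.1) :
    (⟨G, stdPres G S⟩ : AllPres.{u}) ⟶ c' :=
  AllPres.Hom.mk h (FreeGroup.lift t) (by
    refine FreeGroup.ext_hom _ _ fun x => ?_
    change c'.pres.π (FreeGroup.lift t (FreeGroup.of x)) =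
      h (FreeGroup.lift Prod.fst (FreeGroup.of x))
    rw [FreeGroup.lift_apply_of, FreeGroup.lift_apply_of, ht])

/-- `stdPres G PUnit` maps to every free presentation, over any given homomorphism. -/
noncomputable def liftHom {G : GrpCat.{u}} (c' : AllPres.{u}) (h : G →* c'.G) :
    (⟨G, stdPres G PUnit.{u + 1}⟩ : AllPres.{u}) ⟶ c' :=
  stdHom _ c' h (fun x => (c'.pres.surj (h x.1)).choose) fun x => (c'.pres.surj (h x.1)).choose_spec

variable (𝓕 𝓖 : AllPres.{u} ⥤ AddCommGrpCat.{u})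

/-- `Pres(G)` is a large category, but limits of functors `Pres(G) → Ab` exist, since a
compatible family is determined by its value at one presentation that maps to all others. -/
instance hasLimit_fiber (G : GrpCat.{u}) : HasLimit (fiber G ⋙ 𝓕) := by
  let c₀ : Pres G := stdPres G PUnit.{u + 1}
  have hm : ∀ c : Pres G, Nonempty (c₀ ⟶ c) := fun c =>
    ⟨Pres.Hom.mk (liftHom ⟨G, c⟩ (MonoidHom.id _)).hom
      (liftHom ⟨G, c⟩ (MonoidHom.id _)).comm⟩
  have : Small.{u} ((fiber G ⋙ 𝓕) ⋙ forget AddCommGrpCat).sections := by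
    refine small_of_injective
      (f := fun s : ((fiber G ⋙ 𝓕) ⋙ forget AddCommGrpCat).sections => s.1 c₀) ?_
    intro s t hst
    apply Subtype.ext
    funext c
    obtain ⟨f⟩ := hm c
    rw [← s.2 f, ← t.2 f]
    exact congrArg _ hst
  infer_instance

/-- The projections of `lim 𝓕` equalize any two morphisms of presentations with the same base:
the composite only depends on the base. -/
theorem limit_π_std {G : GrpCat.{u}} {c' : AllPres.{u}}
    (φ ψ : (⟨G, stdPres G PUnit.{u + 1}⟩ : AllPres.{u}) ⟶ c') (h : φ.base = ψ.base) :
    limit.π (fiber G ⋙ 𝓕) (stdPres G PUnit.{u + 1}) ≫ 𝓕.map φ =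
      limit.π (fiber G ⋙ 𝓕) (stdPres G PUnit.{u + 1}) ≫ 𝓕.map ψ := by
  let d : Pres G := stdPres G (ULift.{u} Bool)
  let j (b : Bool) (x : G × PUnit.{u + 1}) : FreeGroup (G × ULift.{u} Bool) :=
    FreeGroup.of (x.1, ULift.up b)
  let i (b : Bool) : stdPres G PUnit.{u + 1} ⟶ d :=
    Pres.Hom.mk (FreeGroup.lift (j b))
      (FreeGroup.ext_hom _ _ fun x => by
        change FreeGroup.lift Prod.fst (FreeGroup.lift (j b) (FreeGroup.of x)) =
          FreeGroup.lift Prod.fst (FreeGroup.of x)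
        rw [FreeGroup.lift_apply_of, FreeGroup.lift_apply_of]
        exact Eq.symm (FreeGroup.lift_apply_of (f := (Prod.fst : G × PUnit.{u + 1} → G))))
  have hc : ∀ (χ : (⟨G, stdPres G PUnit.{u + 1}⟩ : AllPres.{u}) ⟶ c') (g : G),
      c'.pres.π (χ.hom (FreeGroup.of (g, PUnit.unit))) = χ.base g := by
    intro χ g
    refine (DFunLike.congr_fun χ.comm (FreeGroup.of (g, PUnit.unit))).trans ?_
    change χ.base (FreeGroup.lift Prod.fst (FreeGroup.of (g, PUnit.unit))) = _
    rw [FreeGroup.lift_apply_of]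
  let t : G × ULift.{u} Bool → c'.pres.F := fun x =>
    bif x.2.down then φ.hom (FreeGroup.of (x.1, PUnit.unit))
    else ψ.hom (FreeGroup.of (x.1, PUnit.unit))
  have ht : ∀ x, c'.pres.π (t x) = φ.base x.1 := by
    rintro ⟨g, ⟨_ | _⟩⟩
    · exact (hc ψ g).trans (by rw [h])
    · exact hc φ g
  let θ := stdHom (G := G) (ULift.{u} Bool) c' φ.base t ht
  have e1 : φ = (fiber G).map (i true) ≫ θ := by
    refine AllPres.Hom.ext rfl (FreeGroup.ext_hom _ _ fun x => ?_)
    change φ.hom (FreeGroup.of x) = FreeGroup.lift t (FreeGroup.lift (j true) (FreeGroup.of x))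
    rw [FreeGroup.lift_apply_of]
    exact Eq.symm (FreeGroup.lift_apply_of (f := t) (x := (x.1, ULift.up true)))
  have e2 : ψ = (fiber G).map (i false) ≫ θ := by
    refine AllPres.Hom.ext h.symm (FreeGroup.ext_hom _ _ fun x => ?_)
    change ψ.hom (FreeGroup.of x) = FreeGroup.lift t (FreeGroup.lift (j false) (FreeGroup.of x))
    rw [FreeGroup.lift_apply_of]
    exact Eq.symm (FreeGroup.lift_apply_of (f := t) (x := (x.1, ULift.up false)))
  have w : ∀ b, limit.π (fiber G ⋙ 𝓕) (stdPres G PUnit.{u + 1}) ≫ 𝓕.map ((fiber G).map (i b)) =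
      limit.π (fiber G ⋙ 𝓕) d := fun b => limit.w (fiber G ⋙ 𝓕) (i b)
  rw [e1, e2, 𝓕.map_comp, 𝓕.map_comp, ← Category.assoc, ← Category.assoc, w, w]

/-- The homomorphism `lim_{Pres(G)} 𝓕 → lim_{Pres(G')} 𝓕` induced by `h : G → G'`: its component
at a presentation `c'` of `G'` comes from any morphism over `h` from a presentation of `G`
to `c'`. -/
noncomputable def limPresHom {G G' : GrpCat.{u}} (h : G ⟶ G') :
    limit (fiber G ⋙ 𝓕) ⟶ limit (fiber G' ⋙ 𝓕) :=
  limit.lift (fiber G' ⋙ 𝓕)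
    { pt := limit (fiber G ⋙ 𝓕)
      π :=
        { app := fun c' => limit.π (fiber G ⋙ 𝓕) (stdPres G PUnit.{u + 1}) ≫
            𝓕.map (liftHom ⟨G', c'⟩ h.hom)
          naturality := by
            intro c' c'' f
            change 𝟙 _ ≫ _ = (_ ≫ _) ≫ 𝓕.map ((fiber G').map f)
            rw [Category.id_comp, Category.assoc, ← 𝓕.map_comp]
            exact limit_π_std 𝓕 _ _ rfl } }

/-- The characterization of `limPresHom`: it is compatible with all morphisms of presentations
over `h`. -/
theorem limPresHom_π {G G' : GrpCat.{u}} (h : G ⟶ G') (c : Pres G) (c' : Pres G')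
    (φ : (⟨G, c⟩ : AllPres.{u}) ⟶ ⟨G', c'⟩) (hφ : φ.base = h.hom) :
    limPresHom 𝓕 h ≫ limit.π (fiber G' ⋙ 𝓕) c' = limit.π (fiber G ⋙ 𝓕) c ≫ 𝓕.map φ := by
  let r : stdPres G PUnit.{u + 1} ⟶ c :=
    Pres.Hom.mk (liftHom ⟨G, c⟩ (MonoidHom.id _)).hom (liftHom ⟨G, c⟩ (MonoidHom.id _)).comm
  have w : limit.π (fiber G ⋙ 𝓕) (stdPres G PUnit.{u + 1}) ≫ 𝓕.map ((fiber G).map r) =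
      limit.π (fiber G ⋙ 𝓕) c := limit.w (fiber G ⋙ 𝓕) r
  rw [limPresHom, limit.lift_π, ← w, Category.assoc, ← 𝓕.map_comp]
  exact limit_π_std 𝓕 _ _ hφ.symm

/-- The functor `G ↦ lim_{Pres(G)} 𝓕` from groups to abelian groups. -/
noncomputable def limPres : GrpCat.{u} ⥤ AddCommGrpCat.{u} where
  obj G := limit (fiber G ⋙ 𝓕)
  map h := limPresHom 𝓕 h
  map_id G := by
    refine limit.hom_ext fun c => ?_
    rw [limPresHom_π 𝓕 (𝟙 G) c c (𝟙 _) rfl, 𝓕.map_id, Category.id_comp]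
    exact Category.comp_id _
  map_comp {G G' G''} h k := by
    refine limit.hom_ext fun c'' => ?_
    let b : Pres G' := stdPres G' PUnit.{u + 1}
    let a : Pres G := stdPres G PUnit.{u + 1}
    let φ : (⟨G, a⟩ : AllPres.{u}) ⟶ ⟨G', b⟩ := liftHom ⟨G', b⟩ h.hom
    let ψ : (⟨G', b⟩ : AllPres.{u}) ⟶ ⟨G'', c''⟩ := liftHom ⟨G'', c''⟩ k.hom
    rw [Category.assoc, limPresHom_π 𝓕 k b c'' ψ rfl, ← Category.assoc, limPresHom_π 𝓕 h a b φ rfl,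
      Category.assoc, ← 𝓕.map_comp]
    exact limPresHom_π 𝓕 (h ≫ k) a c'' (φ ≫ ψ) rfl

variable {𝓕 𝓖}

/-- The homomorphisms `lim_{Pres(G)} 𝓕 → lim_{Pres(G)} 𝓖` induced by a natural
transformation `𝓕 → 𝓖`. -/
noncomputable def limPresMap (α : 𝓕 ⟶ 𝓖) : limPres 𝓕 ⟶ limPres 𝓖 where
  app G := Limits.limMap (Functor.whiskerLeft (fiber G) α)
  naturality {G G'} h := by
    refine limit.hom_ext fun c' => ?_
    let a : Pres G := stdPres G PUnit.{u + 1}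
    let φ : (fiber G).obj a ⟶ (fiber G').obj c' := liftHom ⟨G', c'⟩ h.hom
    change (limPresHom 𝓕 h ≫ Limits.limMap (Functor.whiskerLeft (fiber G') α)) ≫ _ =
      (Limits.limMap (Functor.whiskerLeft (fiber G) α) ≫ limPresHom 𝓖 h) ≫ _
    rw [Category.assoc, Category.assoc, limPresHom_π 𝓖 h a c' φ rfl, Limits.limMap_π, Limits.limMap_π_assoc,
      reassoc_of% limPresHom_π 𝓕 h a c' φ rfl]
    congr 1
    exact α.naturality φ

/-! ### The functors of the exact sequence -/

/-- For a morphism of presentations, `R` is mapped into `R'`. -/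
theorem AllPres.map_R_le {c c' : AllPres.{u}} (f : AllPres.Hom c c') :
    c.pres.R ≤ c'.pres.R.comap f.hom := by
  intro x hx
  have h : c.pres.π x = 1 := hx
  change c'.pres.π (f.hom x) = 1
  rw [← MonoidHom.comp_apply, f.comm, MonoidHom.comp_apply, h, map_one]

theorem AllPres.map_γ₂R_le {c c' : AllPres.{u}} (f : AllPres.Hom c c') :
    ⁅c.pres.R, c.pres.R⁆ ≤ (⁅c'.pres.R, c'.pres.R⁆ : Subgroup c'.pres.F).comap f.hom := by
  rw [← Subgroup.map_le_iff_le_comap, Subgroup.map_commutator]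
  exact Subgroup.commutator_mono (Subgroup.map_le_iff_le_comap.2 (map_R_le f))
    (Subgroup.map_le_iff_le_comap.2 (map_R_le f))

/-- `γ₂(R)(R ∩ γ₄(F))`; here `γ₂(R) = [R, R]` as a subgroup of `F`, and the product of normal
subgroups is their join. -/
abbrev relDenom {G : Type u} [Group G] (c : Pres G) : Subgroup c.F :=
  ⁅c.R, c.R⁆ ⊔ (c.R ⊓ γ 4 c.F)

/-- `γ₂(R)γ₄(F)`. -/
abbrev allDenom {G : Type u} [Group G] (c : Pres G) : Subgroup c.F :=
  ⁅c.R, c.R⁆ ⊔ γ 4 c.F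

theorem relDenom_comm {G : Type u} [Group G] (c : Pres G) :
    ⁅c.R ⊓ γ 2 c.F, c.R ⊓ γ 2 c.F⁆ ≤ relDenom c :=
  (Subgroup.commutator_mono inf_le_left inf_le_left).trans le_sup_left

theorem allDenom_comm {G : Type u} [Group G] (c : Pres G) :
    ⁅γ 2 c.F, γ 2 c.F⁆ ≤ allDenom c :=
  (commutator_γ_two c.F).trans le_sup_right

theorem map_relDenom_le {c c' : AllPres.{u}} (f : AllPres.Hom c c') :
    relDenom c.pres ≤ (relDenom c'.pres).comap f.hom :=
  sup_le (fun _ hx => (le_sup_left : _ ≤ relDenom c'.pres) (AllPres.map_γ₂R_le f hx))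
    fun _ hx => (le_sup_right : _ ≤ relDenom c'.pres)
      ⟨AllPres.map_R_le f hx.1, map_γ_le 4 f.hom hx.2⟩

theorem map_allDenom_le {c c' : AllPres.{u}} (f : AllPres.Hom c c') :
    allDenom c.pres ≤ (allDenom c'.pres).comap f.hom :=
  sup_le (fun _ hx => (le_sup_left : _ ≤ allDenom c'.pres) (AllPres.map_γ₂R_le f hx))
    fun _ hx => (le_sup_right : _ ≤ allDenom c'.pres) (map_γ_le 4 f.hom hx)

/-- The functor `(F, R) ↦ (R ∩ γ₂(F)) / (γ₂(R)(R ∩ γ₄(F)))`. -/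
def relQuot : AllPres.{u} ⥤ AddCommGrpCat.{u} where
  obj c := subquot (c.pres.R ⊓ γ 2 c.pres.F) (relDenom c.pres) (relDenom_comm c.pres)
  map f := subquotMap _ _ f.hom
    (inf_le_inf (AllPres.map_R_le f) (map_γ_le 2 f.hom))
    (map_relDenom_le f)
  map_id _ := subquot_hom_ext fun _ => rfl
  map_comp _ _ := subquot_hom_ext fun _ => rfl

/-- The functor `(F, R) ↦ γ₂(F) / (γ₂(R)γ₄(F))`. -/
def allQuot : AllPres.{u} ⥤ AddCommGrpCat.{u} where
  obj c := subquot (γ 2 c.pres.F) (allDenom c.pres) (allDenom_comm c.pres)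
  map f := subquotMap _ _ f.hom (map_γ_le 2 f.hom)
    (map_allDenom_le f)
  map_id _ := subquot_hom_ext fun _ => rfl
  map_comp _ _ := subquot_hom_ext fun _ => rfl

/-- The natural transformation induced by the inclusions `R ∩ γ₂(F) ⊆ γ₂(F)`. -/
def inclQuot : relQuot.{u} ⟶ allQuot.{u} where
  app c := subquotMap (relDenom_comm c.pres) (allDenom_comm c.pres) (MonoidHom.id _) inf_le_right
    (sup_le_sup_left inf_le_right _)
  naturality _ _ _ := subquot_hom_ext fun _ => rfl

theorem D_four_comm (G : Type u) [Group G] : ⁅D 4 G, D 4 G⁆ ≤ γ 4 G :=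
  have h : D 4 G ≤ γ 2 G := (D_antitone G (show 2 ≤ 4 by norm_num)).trans (D_two_le G)
  (Subgroup.commutator_mono h h).trans (commutator_γ_two G)

/-- The fourth dimension quotient `G ↦ D₄(G) / γ₄(G)`, as a functor from groups to abelian
groups. -/
noncomputable def dimQuot : GrpCat.{u} ⥤ AddCommGrpCat.{u} where
  obj G := subquot (D 4 G) (γ 4 G) (D_four_comm G)
  map f := subquotMap _ _ f.hom (map_D_le 4 f.hom) (map_γ_le 4 f.hom)
  map_id _ := subquot_hom_ext fun _ => rfl
  map_comp _ _ := subquot_hom_ext fun _ => rfl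

/-- The class in `γ₂(F) / (γ₂(R)γ₄(F))` of `w ∈ γ₂(F)`. -/
def allClass {G : GrpCat.{u}} (c : Pres G) (w : γ 2 c.F) : (fiber G ⋙ allQuot).obj c :=
  subquotMk (γ 2 c.F) (allDenom c) (allDenom_comm c) w

/-- The class in `D₄(G) / γ₄(G)` of `g ∈ D₄(G)`. -/
noncomputable def dimClass (G : GrpCat.{u}) (g : D 4 G) : dimQuot.obj G :=
  subquotMk (D 4 G) (γ 4 G) (D_four_comm G) g

end PresLim

open PresLim

/-! The standard presentation maps to every other one, so an element of the limit is determined by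
its component there. The two inclusions into the coproduct of the standard presentation with itself
must send that component, the class of `w`, to the same class. Write 𝔤, 𝔣 for the augmentation
ideals of ℤ[G], ℤ[F], and 𝔯 for the kernel of ℤ[F] → ℤ[G].

Why `π w` lies in D₄(G) (`mem_D_four_of_dupHom`): on the coproduct take the crossed homomorphism to
ℤ[G] that is 0 on the first copy of each generator and `g - 1` on the second. It kills [R, R] and
sends γ₄ into 𝔤⁴, so comparing its values on the two copies of `w` gives π(w) - 1 ∈ 𝔤⁴.

Why every element of D₄(G) occurs: it lifts to some `w` with w - 1 ∈ 𝔯𝔣 + 𝔣⁴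
(`exists_lift_mem_relAugIdeal`). For two morphisms φ, ψ of presentations, a ↦ φ(a)ψ(a)⁻¹ is a
crossed homomorphism into R/γ₂(R) modulo γ₄. Its linear extension kills 𝔯𝔣, because R acts
trivially, and 𝔣⁴, because threefold commutators vanish (`crossedHom_eq_zero`,
`inv_mul_mem_allDenom`). Hence the images of `w` form a compatible family.

Exactness elsewhere is checked presentation by presentation: the modular law gives injectivity,
surjectivity of γ₄(F) → γ₄(G) identifies the kernel, and injectivity makes the pointwise preimages
compatible. -/

namespace PresLim

/-! ### The augmentation ideal -/

section AugmentationIdeal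

variable {H : Type*} [Group H]

instance augIdeal_isTwoSided : (augIdeal H).IsTwoSided := by
  unfold augIdeal; infer_instance

theorem of_sub_one_mem_augIdeal (g : H) : MonoidAlgebra.of ℤ H g - 1 ∈ augIdeal H := by
  simp [augIdeal, RingHom.mem_ker]

theorem mul_mem_augIdeal_pow_succ {n : ℕ} {x y : MonoidAlgebra ℤ H} (hx : x ∈ augIdeal H ^ n)
    (hy : y ∈ augIdeal H) : x * y ∈ augIdeal H ^ (n + 1) := by
  rw [Submodule.pow_succ]; exact Ideal.mul_mem_mul hx hy

theorem mul_mem_augIdeal_pow_succ' {n : ℕ} {x y : MonoidAlgebra ℤ H} (hx : x ∈ augIdeal H)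
    (hy : y ∈ augIdeal H ^ n) : x * y ∈ augIdeal H ^ (n + 1) := by
  rw [Ideal.IsTwoSided.pow_succ]; exact Ideal.mul_mem_mul hx hy

/-- The augmentation ideal is additively generated by the elements `g - 1`. -/
theorem mem_span_of_mem_augIdeal {x : MonoidAlgebra ℤ H} (hx : x ∈ augIdeal H) :
    x ∈ Submodule.span ℤ (Set.range fun g : H => MonoidAlgebra.of ℤ H g - 1) := by
  -- Subtracting the augmentation removes the hypothesis on the element, which makes induction over
  -- all of ℤ[H] possible.
  have key : ∀ y : MonoidAlgebra ℤ H, y - MonoidAlgebra.lift ℤ ℤ H (1 : H →* ℤ) y • 1 ∈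
      Submodule.span ℤ (Set.range fun g : H => MonoidAlgebra.of ℤ H g - 1) := by
    intro y
    induction y using MonoidAlgebra.induction_on with
    | of g =>
      rw [MonoidAlgebra.lift_of, MonoidHom.one_apply, one_smul]
      exact Submodule.subset_span ⟨g, rfl⟩
    | add a b ha hb =>
      rw [map_add, add_smul, add_sub_add_comm]
      exact Submodule.add_mem _ ha hb
    | smul r a ha =>
      rw [map_smul, smul_assoc, ← smul_sub]
      exact Submodule.smul_mem _ _ ha
  have h := key x
  have hx' : MonoidAlgebra.lift ℤ ℤ H (1 : H →* ℤ) x = 0 := hx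
  rwa [hx', zero_smul, sub_zero] at h

/-- The linear extension to `ℤ[H]` of a function on `H`. -/
noncomputable def linExt {A : Type*} [AddCommGroup A] (f : H → A) : MonoidAlgebra ℤ H →ₗ[ℤ] A :=
  (Finsupp.lift A ℤ H f) ∘ₗ (MonoidAlgebra.coeffLinearEquiv ℤ).toLinearMap

theorem linExt_of {A : Type*} [AddCommGroup A] (f : H → A) (h : H) :
    linExt f (MonoidAlgebra.of ℤ H h) = f h := by
  simp [linExt]

/-- A linear map out of `ℤ[H]` that extends a crossed homomorphism `H → A` vanishes on the left
ideal generated by the products `(r - 1)(a - 1)` with `r` acting trivially on `A`, and on the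
fourth power of the augmentation ideal if its third power annihilates `A`. -/
theorem crossedHom_eq_zero {A : Type*} [AddCommGroup A] (ρ : H →* Module.End ℤ A) (δ : H → A)
    (hδ : ∀ a b, δ (a * b) = δ a + ρ a (δ b)) (R : Subgroup H) (hR : ∀ r ∈ R, ρ r = 1)
    (h3 : ∀ a b c : H, (ρ a - 1) * (ρ b - 1) * (ρ c - 1) = 0) {w : H}
    (hw : MonoidAlgebra.of ℤ H w - 1 ∈
      Ideal.span {x | ∃ r ∈ R, ∃ a : H,
        x = (MonoidAlgebra.of ℤ H r - 1) * (MonoidAlgebra.of ℤ H a - 1)} ⊔ augIdeal H ^ 4) :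
    δ w = 0 := by
  let T : MonoidAlgebra ℤ H →ₐ[ℤ] Module.End ℤ A := MonoidAlgebra.lift ℤ _ H ρ
  have hT : ∀ a, T (MonoidAlgebra.of ℤ H a) = ρ a := fun a => MonoidAlgebra.lift_of _ _
  let L := linExt δ
  have hL : ∀ a, L (MonoidAlgebra.of ℤ H a) = δ a := linExt_of δ
  have δ1 : δ 1 = 0 := by
    have := hδ 1 1
    rw [mul_one, map_one, Module.End.one_apply] at this
    exact left_eq_add.1 this
  have L1 : ∀ a, L (MonoidAlgebra.of ℤ H a - 1) = δ a := fun a => by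
    rw [map_sub, hL, ← map_one (MonoidAlgebra.of ℤ H), hL, δ1, sub_zero]
  have key1 : ∀ (x : MonoidAlgebra ℤ H) (a : H),
      L (x * (MonoidAlgebra.of ℤ H a - 1)) = T x (δ a) := by
    intro x a
    induction x using MonoidAlgebra.induction_on with
    | of g => rw [mul_sub, mul_one, ← map_mul, map_sub, hL, hL, hT, hδ, add_sub_cancel_left]
    | add x y hx hy => rw [add_mul, map_add, hx, hy, map_add, LinearMap.add_apply]
    | smul r x hx => rw [smul_mul_assoc, map_smul, hx, map_smul, LinearMap.smul_apply]
  -- `L` is ℤ[H]-linear only on the augmentation ideal: at `y = 1` the right side is 0, but `L x`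
  -- need not be.
  have key2 : ∀ x y : MonoidAlgebra ℤ H, y ∈ augIdeal H → L (x * y) = T x (L y) := by
    intro x y hy
    refine Submodule.span_induction (p := fun y _ => L (x * y) = T x (L y)) ?_ ?_ ?_ ?_
      (mem_span_of_mem_augIdeal hy)
    · rintro _ ⟨a, rfl⟩
      rw [key1, L1]
    · rw [mul_zero, map_zero, map_zero]
    · intro y z _ _ hy hz
      rw [mul_add, map_add, hy, hz, map_add, map_add]
    · intro r y _ hy
      rw [mul_smul_comm, map_smul, hy, map_smul, map_smul]
  have T1 : ∀ a, T (MonoidAlgebra.of ℤ H a - 1) = ρ a - 1 := fun a => by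
    rw [map_sub, hT, map_one]
  have T3 : augIdeal H ^ 3 ≤ RingHom.ker T := by
    rw [Submodule.pow_succ, Submodule.pow_succ, Submodule.pow_one]
    have hz : ∀ x ∈ augIdeal H, ∀ y ∈ augIdeal H, ∀ z ∈ augIdeal H, T (x * y * z) = 0 := by
      intro x hx y hy z hz
      refine Submodule.span_induction (p := fun x _ => T (x * y * z) = 0) ?_ ?_ ?_ ?_
        (mem_span_of_mem_augIdeal hx)
      · rintro _ ⟨a, rfl⟩
        refine Submodule.span_induction
          (p := fun y _ => T ((MonoidAlgebra.of ℤ H a - 1) * y * z) = 0) ?_ ?_ ?_ ?_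
          (mem_span_of_mem_augIdeal hy)
        · rintro _ ⟨b, rfl⟩
          refine Submodule.span_induction (p := fun z _ =>
            T ((MonoidAlgebra.of ℤ H a - 1) * (MonoidAlgebra.of ℤ H b - 1) * z) = 0) ?_ ?_ ?_ ?_
            (mem_span_of_mem_augIdeal hz)
          · rintro _ ⟨c, rfl⟩
            rw [map_mul, map_mul, T1, T1, T1, h3]
          · rw [mul_zero, map_zero]
          · intro u v _ _ hu hv
            rw [mul_add, map_add, hu, hv, add_zero]
          · intro r u _ hu
            rw [mul_smul_comm, map_smul, hu, smul_zero]
        · rw [mul_zero, zero_mul, map_zero]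
        · intro u v _ _ hu hv
          rw [mul_add, add_mul, map_add, hu, hv, add_zero]
        · intro r u _ hu
          rw [mul_smul_comm, smul_mul_assoc, map_smul, hu, smul_zero]
      · rw [zero_mul, zero_mul, map_zero]
      · intro u v _ _ hu hv
        rw [add_mul, add_mul, map_add, hu, hv, add_zero]
      · intro r u _ hu
        rw [smul_mul_assoc, smul_mul_assoc, map_smul, hu, smul_zero]
    refine Ideal.mul_le.2 fun x hx z hz' => ?_
    refine Submodule.smul_induction_on hx ?_ ?_
    · intro x hx y hy
      exact hz x hx y hy z hz'
    · intro x y hx hy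
      rw [add_mul]
      exact Ideal.add_mem _ hx hy
  obtain ⟨x, hx, y, hy, hxy⟩ := Submodule.mem_sup.1 hw
  have hx0 : L x = 0 := by
    -- Membership in the augmentation ideal is carried along because `key2` needs it for left
    -- multiples.
    refine (Submodule.span_induction (p := fun x _ => x ∈ augIdeal H ∧ L x = 0) ?_ ?_ ?_ ?_ hx).2
    · rintro _ ⟨r, hr, a, rfl⟩
      refine ⟨Ideal.mul_mem_left _ _ (of_sub_one_mem_augIdeal a), ?_⟩
      rw [key1, T1, hR r hr, sub_self, LinearMap.zero_apply]
    · exact ⟨Ideal.zero_mem _, map_zero _⟩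
    · intro u v _ _ hu hv
      exact ⟨Ideal.add_mem _ hu.1 hv.1, by rw [map_add, hu.2, hv.2, add_zero]⟩
    · intro r u _ hu
      exact ⟨Ideal.mul_mem_left _ _ hu.1, by rw [smul_eq_mul, key2 _ _ hu.1, hu.2, map_zero]⟩
  have hy0 : L y = 0 := by
    -- Split 𝔥⁴ as 𝔥³ · 𝔥: the last factor lets `key2` apply, and the first three kill the module.
    rw [Submodule.pow_succ] at hy
    refine Submodule.smul_induction_on hy ?_ ?_
    · intro u hu v hv
      have hu0 : T u = 0 := T3 hu
      rw [smul_eq_mul, key2 _ _ hv, hu0, LinearMap.zero_apply]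
    · intro u v hu hv
      rw [map_add, hu, hv, add_zero]
  rw [← L1, ← hxy, map_add, hx0, hy0, add_zero]

end AugmentationIdeal

/-! ### Crossed homomorphisms with values in a group ring -/

section CrossedHom

open scoped commutatorElement

variable {E G : Type*} [Group E] [Group G] (π : E →* G) (δ : E → MonoidAlgebra ℤ G)


/-- The elements at which a crossed homomorphism takes values in a given left ideal. -/
def crossedPreimage
    (hδ : ∀ a b, δ (a * b) = δ a + MonoidAlgebra.of ℤ G (π a) * δ b)
    (J : Ideal (MonoidAlgebra ℤ G)) : Subgroup E where
  carrier := {a | δ a ∈ J}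
  one_mem' := by
    have := hδ 1 1
    rw [mul_one, map_one, map_one, one_mul] at this
    change δ 1 ∈ J
    rw [left_eq_add.1 this]
    exact J.zero_mem
  mul_mem' {a b} ha hb := by
    change δ (a * b) ∈ J
    rw [hδ]
    exact J.add_mem ha (J.mul_mem_left _ hb)
  inv_mem' {a} ha := by
    have h1 := hδ 1 1
    rw [mul_one, map_one, map_one, one_mul] at h1
    have h2 := hδ a⁻¹ a
    rw [inv_mul_cancel, left_eq_add.1 h1] at h2
    change δ a⁻¹ ∈ J
    rw [eq_neg_of_add_eq_zero_left h2.symm]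
    exact J.neg_mem (J.mul_mem_left _ ha)

/-- Evaluate δ on both sides of ab = [a, b]ba and solve for the commutator term. -/
theorem crossedHom_commutator
    (hδ : ∀ a b, δ (a * b) = δ a + MonoidAlgebra.of ℤ G (π a) * δ b)
    (a b : E) : δ ⁅a, b⁆ =
    (1 - MonoidAlgebra.of ℤ G (π (⁅a, b⁆ * b))) * δ a +
      (MonoidAlgebra.of ℤ G (π a) - MonoidAlgebra.of ℤ G (π ⁅a, b⁆)) * δ b := by
  have h : δ (a * b) = δ (⁅a, b⁆ * b * a) := by
    rw [commutatorElement_def]; group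
  rw [hδ, hδ, hδ] at h
  rw [sub_mul, one_mul, sub_mul]
  linear_combination (norm := abel) -h

/-- In the commutator formula the coefficient of δ(a) lies in 𝔤 and that of δ(b) in 𝔤ⁿ, so each
summand gains one power. This is the inductive step along the lower central series. -/
theorem crossedHom_commutator_mem 
    (hδ : ∀ a b, δ (a * b) = δ a + MonoidAlgebra.of ℤ G (π a) * δ b)
    {n : ℕ} (haug : ∀ a, δ a ∈ augIdeal G) {a : E}
    (ha : δ a ∈ augIdeal G ^ n) (hπ : π a ∈ D n G) (b : E) (hab : π ⁅a, b⁆ ∈ D n G) :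
    δ ⁅a, b⁆ ∈ augIdeal G ^ (n + 1) := by
  rw [crossedHom_commutator π δ hδ]
  refine Ideal.add_mem _ (mul_mem_augIdeal_pow_succ' ?_ ha) (mul_mem_augIdeal_pow_succ ?_ (haug b))
  · rw [← neg_sub]
    exact (Ideal.neg_mem_iff _).2 (of_sub_one_mem_augIdeal _)
  · rw [← sub_sub_sub_cancel_right _ _ (1 : MonoidAlgebra ℤ G)]
    exact Ideal.sub_mem _ (mem_D.1 hπ) (mem_D.1 hab)

/-- For a, b in the kernel both coefficients in the commutator formula vanish, so δ is zero on such
commutators. -/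
theorem commutator_ker_le_crossedPreimage 
    (hδ : ∀ a b, δ (a * b) = δ a + MonoidAlgebra.of ℤ G (π a) * δ b)
    (J : Ideal (MonoidAlgebra ℤ G)) :
    ⁅π.ker, π.ker⁆ ≤ crossedPreimage π δ hδ J := by
  rw [Subgroup.commutator_le]
  intro a ha b hb
  change δ ⁅a, b⁆ ∈ J
  rw [MonoidHom.mem_ker] at ha hb
  rw [crossedHom_commutator π δ hδ, map_mul, map_commutatorElement, ha, hb]
  rw [commutatorElement_one_left, one_mul, map_one, sub_self, zero_mul, zero_mul,
    add_zero]
  exact J.zero_mem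

/-- Makes g ↦ g - 1 a crossed homomorphism over the identity, so that the commutator estimate also
yields γₙ ⊆ Dₙ. -/
theorem of_mul_sub_one (a b : G) : MonoidAlgebra.of ℤ G (a * b) - 1 =
    (MonoidAlgebra.of ℤ G a - 1) +
      MonoidAlgebra.of ℤ G (MonoidHom.id G a) * (MonoidAlgebra.of ℤ G b - 1) := by
  rw [map_mul, mul_sub, mul_one, MonoidHom.id_apply, add_comm, sub_add_sub_cancel]

instance D_normal (n : ℕ) : (D n G).Normal where
  conj_mem a ha g := by
    have h : MonoidAlgebra.of ℤ G (g * a * g⁻¹) - 1 = MonoidAlgebra.of ℤ G g *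
        (MonoidAlgebra.of ℤ G a - 1) * MonoidAlgebra.of ℤ G g⁻¹ := by
      rw [mul_sub, sub_mul, mul_one, ← map_mul, ← map_mul, ← map_mul, mul_inv_cancel, map_one]
    rw [mem_D, h]
    exact Ideal.mul_mem_right _ _ (Ideal.mul_mem_left _ _ (mem_D.1 ha))

/-- `γ_{n+1}(G) ⊆ D_{n+1}(G)`. -/
theorem lowerCentralSeries_le_D (n : ℕ) : (⊤ : Subgroup G).lowerCentralSeries n ≤ D (n + 1) G := by
  induction n with
  | zero =>
    intro a _
    rw [mem_D, zero_add, Submodule.pow_one]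
    exact of_sub_one_mem_augIdeal a
  | succ n ih =>
    rw [Subgroup.lowerCentralSeries_succ, Subgroup.commutator_le]
    intro a ha b _
    refine mem_D.2 (crossedHom_commutator_mem (MonoidHom.id G)
      (fun a => MonoidAlgebra.of ℤ G a - 1) of_mul_sub_one of_sub_one_mem_augIdeal
      (mem_D.1 (ih ha)) (ih ha) b ?_)
    -- [a, b] = a · (b a⁻¹ b⁻¹) is a product of two elements of the normal subgroup.
    have := (D_normal (G := G) (n + 1)).conj_mem _ (inv_mem (ih ha)) b
    have := mul_mem (ih ha) this
    rwa [← mul_assoc, ← mul_assoc] at this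

/-- Each commutator raises the power of 𝔤 by one. With numbering from zero, the case `n = 3` says
that δ maps γ₄ into 𝔤⁴. -/
theorem lowerCentralSeries_le_crossedPreimage 
    (hδ : ∀ a b, δ (a * b) = δ a + MonoidAlgebra.of ℤ G (π a) * δ b)
    (haug : ∀ a, δ a ∈ augIdeal G) (n : ℕ) :
    (⊤ : Subgroup E).lowerCentralSeries n ≤ crossedPreimage π δ hδ (augIdeal G ^ (n + 1)) := by
  have hπ : ∀ n, ∀ a ∈ (⊤ : Subgroup E).lowerCentralSeries n, π a ∈ D (n + 1) G :=
    fun n a ha => lowerCentralSeries_le_D n (map_γ_le (n + 1) π ha)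
  induction n with
  | zero =>
    intro a _
    change δ a ∈ augIdeal G ^ (0 + 1)
    rw [zero_add, Submodule.pow_one]
    exact haug a
  | succ n ih =>
    rw [Subgroup.lowerCentralSeries_succ, Subgroup.commutator_le]
    intro a ha b hb
    refine crossedHom_commutator_mem π δ hδ haug (ih ha) (hπ n a ha) b (hπ n _ ?_)
    exact (Subgroup.lowerCentralSeries_antitone (S := (⊤ : Subgroup E))) n.le_succ
      (Subgroup.commutator_mem_commutator ha hb)

end CrossedHom

/-- There is a crossed homomorphism on a free group with prescribed values on the generators. -/
theorem exists_crossedHom {X G : Type*} [Group G] (p : X → G) (f : X → MonoidAlgebra ℤ G) :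
    ∃ δ : FreeGroup X → MonoidAlgebra ℤ G,
      (∀ a b, δ (a * b) = δ a + MonoidAlgebra.of ℤ G (FreeGroup.lift p a) * δ b) ∧
        ∀ x, δ (FreeGroup.of x) = f x := by
  let act : G →* MulAut (Multiplicative (MonoidAlgebra ℤ G)) :=
    { toFun := fun g =>
        { toFun := fun x => Multiplicative.ofAdd (MonoidAlgebra.of ℤ G g * Multiplicative.toAdd x)
          invFun := fun x =>
            Multiplicative.ofAdd (MonoidAlgebra.of ℤ G g⁻¹ * Multiplicative.toAdd x)
          left_inv := fun x => by
            beta_reduce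
            rw [toAdd_ofAdd, ← mul_assoc, ← map_mul, inv_mul_cancel, map_one, one_mul, ofAdd_toAdd]
          right_inv := fun x => by
            beta_reduce
            rw [toAdd_ofAdd, ← mul_assoc, ← map_mul, mul_inv_cancel, map_one, one_mul, ofAdd_toAdd]
          map_mul' := fun x y => by rw [toAdd_mul, mul_add, ofAdd_add] }
      map_one' := by
        ext1 x
        change Multiplicative.ofAdd (MonoidAlgebra.of ℤ G 1 * Multiplicative.toAdd x) = x
        rw [map_one, one_mul, ofAdd_toAdd]
      map_mul' := fun g h => by
        ext1 x
        change Multiplicative.ofAdd (MonoidAlgebra.of ℤ G (g * h) * Multiplicative.toAdd x) =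
          Multiplicative.ofAdd (MonoidAlgebra.of ℤ G g * (MonoidAlgebra.of ℤ G h *
            Multiplicative.toAdd x))
        rw [(MonoidAlgebra.of ℤ G).map_mul, mul_assoc] }
  -- A crossed homomorphism is the left component of a homomorphism to the semidirect product, and
  -- the latter is free to prescribe on generators.
  let θ : FreeGroup X →* Multiplicative (MonoidAlgebra ℤ G) ⋊[act] G :=
    FreeGroup.lift fun x => ⟨Multiplicative.ofAdd (f x), p x⟩
  have hθ : ∀ a, (θ a).right = FreeGroup.lift p a := by
    intro a
    refine DFunLike.congr_fun (f := SemidirectProduct.rightHom.comp θ) ?_ a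
    refine FreeGroup.ext_hom _ _ fun x => ?_
    simp [θ]
  refine ⟨fun a => Multiplicative.toAdd (θ a).left, fun a b => ?_, fun x => ?_⟩
  · beta_reduce
    rw [map_mul θ, SemidirectProduct.mul_left, ← hθ]
    rfl
  · simp [θ]

/-- A crossed homomorphism on a free group takes values in any left ideal that contains its values
on the generators. -/
theorem crossedHom_mem_of_generators {X G : Type*} [Group G] (π : FreeGroup X →* G)
    (δ : FreeGroup X → MonoidAlgebra ℤ G)
    (hδ : ∀ a b, δ (a * b) = δ a + MonoidAlgebra.of ℤ G (π a) * δ b)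
    (J : Ideal (MonoidAlgebra ℤ G)) (hJ : ∀ x, δ (FreeGroup.of x) ∈ J) (a : FreeGroup X) :
    δ a ∈ J := by
  have : (⊤ : Subgroup (FreeGroup X)) ≤ crossedPreimage π δ hδ J := by
    rw [← FreeGroup.closure_range_of, Subgroup.closure_le]
    rintro _ ⟨x, rfl⟩
    exact hJ x
  exact this (Subgroup.mem_top a)

/-! ### Components of limit elements project into D₄(G) -/

/-- The two inclusions of the standard presentation in its coproduct with itself. -/
def dupHom (G : Type u) [Group G] (b : Bool) :
    stdPres G PUnit.{u + 1} ⟶ stdPres G (ULift.{u} Bool) :=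
  Pres.Hom.mk (FreeGroup.lift fun x => FreeGroup.of (x.1, ULift.up b))
    (FreeGroup.ext_hom _ _ fun x => by
      change FreeGroup.lift Prod.fst (FreeGroup.lift
        (fun x : G × PUnit.{u + 1} => FreeGroup.of (x.1, ULift.up.{u} b)) (FreeGroup.of x)) =
          FreeGroup.lift Prod.fst (FreeGroup.of x)
      rw [FreeGroup.lift_apply_of, FreeGroup.lift_apply_of]
      exact Eq.symm (FreeGroup.lift_apply_of (f := (Prod.fst : G × PUnit.{u + 1} → G))))

theorem Pres.Hom.π_apply {G : Type u} [Group G] {c c' : Pres G} (φ : c ⟶ c') (a : c.F) :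
    c'.π (Pres.Hom.hom φ a) = c.π a :=
  DFunLike.congr_fun (Pres.Hom.comm φ) a

theorem dupHom_of (G : Type u) [Group G] (b : Bool) (x : G × PUnit.{u + 1}) :
    (dupHom G b).hom (FreeGroup.of x) = FreeGroup.of (x.1, ULift.up b) :=
  FreeGroup.lift_apply_of

theorem stdPres_π_of (G : Type u) [Group G] (S : Type u) [Nonempty S] (x : G × S) :
    (stdPres G S).π (FreeGroup.of x) = x.1 :=
  FreeGroup.lift_apply_of

/-- If the two inclusions in the coproduct agree on `w` modulo `γ₂(R)γ₄(F)`, then the image of `w`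
in `G` is in the fourth dimension subgroup. -/
theorem mem_D_four_of_dupHom (G : Type u) [Group G] (w : (stdPres G PUnit.{u + 1}).F)
    (hw : ((dupHom G false).hom w)⁻¹ * (dupHom G true).hom w ∈
      allDenom (stdPres G (ULift.{u} Bool))) :
    (stdPres G PUnit.{u + 1}).π w ∈ D 4 G := by
  let d := stdPres G (ULift.{u} Bool)
  obtain ⟨δ, hδ, hof⟩ : ∃ δ : d.F → MonoidAlgebra ℤ G,
      (∀ a b, δ (a * b) = δ a + MonoidAlgebra.of ℤ G (d.π a) * δ b) ∧
        ∀ x : G × ULift.{u} Bool, δ (FreeGroup.of x) =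
          bif x.2.down then MonoidAlgebra.of ℤ G x.1 - 1 else 0 :=
    exists_crossedHom (X := G × ULift.{u} Bool) Prod.fst _
  have haug : ∀ a, δ a ∈ augIdeal G := by
    refine crossedHom_mem_of_generators (X := G × ULift.{u} Bool) d.π δ hδ _ fun x => ?_
    rw [hof]
    rcases x with ⟨g, ⟨_ | _⟩⟩
    · exact Ideal.zero_mem _
    · exact of_sub_one_mem_augIdeal g
  have hcomp : ∀ (b : Bool) (u v : (stdPres G PUnit.{u + 1}).F),
      δ ((dupHom G b).hom (u * v)) = δ ((dupHom G b).hom u) +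
        MonoidAlgebra.of ℤ G ((stdPres G PUnit.{u + 1}).π u) * δ ((dupHom G b).hom v) := by
    intro b u v
    rw [map_mul, ← Pres.Hom.π_apply (dupHom G b) u]
    exact hδ _ _
  -- The difference of two crossed homomorphisms over the same π is again one, so it vanishes if it
  -- vanishes on generators; below this is applied with the zero ideal.
  have hsub : ∀ u v : (stdPres G PUnit.{u + 1}).F, δ ((dupHom G true).hom (u * v)) -
      (MonoidAlgebra.of ℤ G ((stdPres G PUnit.{u + 1}).π (u * v)) - 1) =
        (δ ((dupHom G true).hom u) - (MonoidAlgebra.of ℤ G ((stdPres G PUnit.{u + 1}).π u) - 1)) +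
        MonoidAlgebra.of ℤ G ((stdPres G PUnit.{u + 1}).π u) * (δ ((dupHom G true).hom v) -
          (MonoidAlgebra.of ℤ G ((stdPres G PUnit.{u + 1}).π v) - 1)) := by
    intro u v
    rw [hcomp, map_mul (stdPres G PUnit.{u + 1}).π, of_mul_sub_one, MonoidHom.id_apply,
      mul_sub _ (δ _)]
    abel
  have h0 : δ ((dupHom G false).hom w) = 0 := by
    refine (Submodule.mem_bot _).1 (crossedHom_mem_of_generators (X := G × PUnit.{u + 1})
      (stdPres G PUnit.{u + 1}).π
      (fun w => δ ((dupHom G false).hom w)) (hcomp false) ⊥ (fun x => ?_) w)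
    rw [dupHom_of, hof]
    exact Submodule.zero_mem _
  have h1 : δ ((dupHom G true).hom w) - (MonoidAlgebra.of ℤ G ((stdPres G PUnit.{u + 1}).π w) - 1) =
      0 := by
    refine (Submodule.mem_bot _).1 (crossedHom_mem_of_generators (X := G × PUnit.{u + 1})
      (stdPres G PUnit.{u + 1}).π
      (fun w => δ ((dupHom G true).hom w) -
        (MonoidAlgebra.of ℤ G ((stdPres G PUnit.{u + 1}).π w) - 1)) hsub ⊥ (fun x => ?_) w)
    rw [dupHom_of, hof, stdPres_π_of, cond_true, sub_self]
    exact Submodule.zero_mem _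
  have h4 : allDenom d ≤ crossedPreimage d.π δ hδ (augIdeal G ^ 4) :=
    sup_le (commutator_ker_le_crossedPreimage _ _ _ _)
      (lowerCentralSeries_le_crossedPreimage d.π δ hδ haug 3)
  have h5 := Ideal.mul_mem_left (augIdeal G ^ 4) (MonoidAlgebra.of ℤ G (d.π ((dupHom G false).hom w))) (h4 hw)
  -- Expand δ on i₁(w) = i₀(w) · (i₀(w)⁻¹ i₁(w)), where δ(i₀(w)) = 0 and δ of the last factor is in
  -- 𝔤⁴.
  have h6 := hδ ((dupHom G false).hom w) (((dupHom G false).hom w)⁻¹ * (dupHom G true).hom w)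
  rw [mul_inv_cancel_left, h0, zero_add] at h6
  rw [mem_D, ← sub_eq_zero.1 h1, h6]
  exact h5

/-! ### Morphisms of presentations agree on F ∩ (1 + 𝔯𝔣 + 𝔣⁴) -/

/-- The left ideal of `ℤ[F]` generated by the products `(r - 1)(a - 1)` with `r ∈ R`, `a ∈ F`. -/
noncomputable def relAugIdeal {F : Type*} [Group F] (R : Subgroup F) : Ideal (MonoidAlgebra ℤ F) :=
  Ideal.span {x | ∃ r ∈ R, ∃ a : F,
    x = (MonoidAlgebra.of ℤ F r - 1) * (MonoidAlgebra.of ℤ F a - 1)}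

open scoped commutatorElement IsMulCommutative in
/-- Two homomorphisms `φ, ψ` to a group `Q` of nilpotency class at most three, congruent modulo an
abelian normal subgroup, agree on `F ∩ (1 + 𝔯𝔣 + 𝔣⁴)`. -/
theorem eq_of_sub_one_mem_relAugIdeal {F Q : Type*} [Group F] [Group Q] (M : Subgroup Q) [M.Normal]
    [IsMulCommutative M] (hQ : γ 4 Q = ⊥) (φ ψ : F →* Q) (hφψ : ∀ a, φ a * (ψ a)⁻¹ ∈ M)
    (R : Subgroup F) (hR : ∀ r ∈ R, φ r ∈ M) {w : F}
    (hw : MonoidAlgebra.of ℤ F w - 1 ∈ relAugIdeal R ⊔ augIdeal F ^ 4) : φ w = ψ w := by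
  -- F acts on M by conjugation through φ; then `ρ a - 1` is x ↦ [φ(a), x].
  let ρ : F →* Module.End ℤ (Additive M) :=
    { toFun := fun a =>
        (MonoidHom.toAdditive (MulAut.conjNormal (H := M) (φ a)).toMonoidHom).toIntLinearMap
      map_one' := by
        refine LinearMap.ext fun x => ?_
        apply Additive.toMul.injective
        apply Subtype.ext
        change φ 1 * _ * (φ 1)⁻¹ = _
        simp
      map_mul' := fun a b => by
        refine LinearMap.ext fun x => ?_
        apply Additive.toMul.injective
        apply Subtype.ext
        change φ (a * b) * (x.toMul : Q) * (φ (a * b))⁻¹ =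
          φ a * (φ b * (x.toMul : Q) * (φ b)⁻¹) * (φ a)⁻¹
        rw [map_mul, mul_inv_rev]
        group }
  have hρ : ∀ a (x : Additive M), (((ρ a - 1) x).toMul : Q) = ⁅φ a, (x.toMul : Q)⁆ := fun a x => by
    rw [LinearMap.sub_apply, Module.End.one_apply, toMul_sub, Subgroup.coe_div, div_eq_mul_inv]
    rfl
  let δ : F → Additive M := fun a => Additive.ofMul ⟨φ a * (ψ a)⁻¹, hφψ a⟩
  have h := crossedHom_eq_zero ρ δ (fun a b => ?_) R (fun r hr => ?_) (fun a b c => ?_) hw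
  · have h' : φ w * (ψ w)⁻¹ = 1 := congrArg (fun x : Additive M => (x.toMul : Q)) h
    exact mul_inv_eq_one.1 h'
  -- Commutativity of M puts the conjugated factor first, so that φ(a)⁻¹φ(a) cancels in the middle.
  · rw [add_comm]
    apply Additive.toMul.injective
    apply Subtype.ext
    change φ (a * b) * (ψ (a * b))⁻¹ = φ a * (φ b * (ψ b)⁻¹) * (φ a)⁻¹ * (φ a * (ψ a)⁻¹)
    rw [map_mul, map_mul, mul_inv_rev]
    group
  · refine LinearMap.ext fun x => ?_
    apply Additive.toMul.injective
    apply Subtype.ext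
    have := congrArg Subtype.val (mul_comm (⟨φ r, hR r hr⟩ : M) x.toMul)
    change φ r * (x.toMul : Q) * (φ r)⁻¹ = (x.toMul : Q)
    rw [mul_inv_eq_iff_eq_mul]
    exact this
  · refine LinearMap.ext fun x => ?_
    apply Additive.toMul.injective
    apply Subtype.ext
    change ((((ρ a - 1) ((ρ b - 1) ((ρ c - 1) x))).toMul : M) : Q) = 1
    rw [hρ, hρ, hρ, ← Subgroup.mem_bot, ← hQ]
    -- Three nested commutators, starting from an arbitrary element of Q, land in γ₄(Q) = 1.
    have hsucc : ∀ n (u v : Q), v ∈ (⊤ : Subgroup Q).lowerCentralSeries n →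
        ⁅u, v⁆ ∈ (⊤ : Subgroup Q).lowerCentralSeries (n + 1) := fun n u v hv => by
      rw [Subgroup.lowerCentralSeries_succ, Subgroup.commutator_comm]
      exact Subgroup.commutator_mem_commutator (Subgroup.mem_top u) hv
    exact hsucc 2 _ _ (hsucc 1 _ _ (hsucc 0 _ _ (Subgroup.mem_top _)))

/-- Any two morphisms of presentations agree on `F ∩ (1 + 𝔯𝔣 + 𝔣⁴)` modulo `γ₂(R)γ₄(F)`. -/
theorem inv_mul_mem_allDenom {G : Type u} [Group G] {c c' : Pres G} (φ ψ : c ⟶ c') {w : c.F}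
    (hw : MonoidAlgebra.of ℤ c.F w - 1 ∈ relAugIdeal c.R ⊔ augIdeal c.F ^ 4) :
    (Pres.Hom.hom φ w)⁻¹ * Pres.Hom.hom ψ w ∈ allDenom c' := by
  let q := QuotientGroup.mk' (allDenom c')
  have hq : Function.Surjective q := QuotientGroup.mk'_surjective _
  have hker : ∀ K ≤ allDenom c', K.map q = ⊥ := fun K hK => by
    rwa [Subgroup.map_eq_bot_iff, QuotientGroup.ker_mk']
  let M : Subgroup (c'.F ⧸ allDenom c') := c'.R.map q
  have : M.Normal := Subgroup.Normal.map inferInstance q hq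
  -- [R, R] lies in the denominator, so the image of R in the quotient is abelian.
  have : IsMulCommutative M := by
    rw [← Subgroup.commutator_self_eq_bot_iff, ← Subgroup.map_commutator]
    exact hker _ le_sup_left
  have h4 : γ 4 (c'.F ⧸ allDenom c') = ⊥ := by
    rw [← hker (γ 4 c'.F) le_sup_right]
    exact ((Subgroup.map_lowerCentralSeries ⊤ q 3).trans (by
      rw [Subgroup.map_top_of_surjective q hq]; rfl)).symm
  refine QuotientGroup.eq.1 (eq_of_sub_one_mem_relAugIdeal M h4 (q.comp (Pres.Hom.hom φ))
    (q.comp (Pres.Hom.hom ψ)) (fun a => ?_) c.R (fun r hr => ?_) hw)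
  · refine ⟨Pres.Hom.hom φ a * (Pres.Hom.hom ψ a)⁻¹, ?_, by simp⟩
    change c'.π _ = 1
    rw [map_mul, map_inv, Pres.Hom.π_apply, Pres.Hom.π_apply, mul_inv_cancel]
  · exact ⟨_, (Pres.Hom.π_apply φ r).trans hr, rfl⟩

/-! ### Lifting elements of D₄(G) to the free group -/

/-- A surjective homomorphism of groups maps `𝔥ⁿ` onto `𝔨ⁿ`. -/
theorem exists_mem_augIdeal_pow {H K : Type*} [Group H] [Group K] (f : H →* K)
    (hf : Function.Surjective f) (n : ℕ) {y : MonoidAlgebra ℤ K} (hy : y ∈ augIdeal K ^ n) :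
    ∃ x ∈ augIdeal H ^ n, MonoidAlgebra.mapDomainRingHom ℤ f x = y := by
  have hs : Function.Surjective (MonoidAlgebra.mapDomainRingHom ℤ f) := by
    intro y
    induction y using MonoidAlgebra.induction_on with
    | of k =>
      obtain ⟨h, rfl⟩ := hf k
      exact ⟨MonoidAlgebra.of ℤ H h, by simp⟩
    | add a b ha hb =>
      obtain ⟨x, rfl⟩ := ha
      obtain ⟨z, rfl⟩ := hb
      exact ⟨x + z, map_add _ _ _⟩
    | smul r a ha =>
      obtain ⟨x, rfl⟩ := ha
      exact ⟨r • x, map_zsmul _ _ _⟩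
  -- The induced map preserves augmentations, so any lift of an element of the augmentation ideal is
  -- usable.
  have h1 : ∀ x, MonoidAlgebra.mapDomainRingHom ℤ f x ∈ augIdeal K → x ∈ augIdeal H := by
    intro x hx
    have : ((MonoidAlgebra.lift ℤ ℤ K (1 : K →* ℤ) : MonoidAlgebra ℤ K →+* ℤ).comp
        (MonoidAlgebra.mapDomainRingHom ℤ f)) =
        (MonoidAlgebra.lift ℤ ℤ H (1 : H →* ℤ) : MonoidAlgebra ℤ H →+* ℤ) := by
      ext <;> simp
    exact (RingHom.congr_fun this x).symm.trans hx
  induction n generalizing y with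
  | zero =>
    obtain ⟨x, hx⟩ := hs y
    refine ⟨x, ?_, hx⟩
    rw [Submodule.pow_zero, Ideal.one_eq_top]
    trivial
  | succ n ih =>
    rw [Submodule.pow_succ] at hy
    refine Submodule.smul_induction_on hy ?_ ?_
    · intro a ha b hb
      obtain ⟨x, hx, rfl⟩ := ih ha
      obtain ⟨z, rfl⟩ := hs b
      exact ⟨x * z, mul_mem_augIdeal_pow_succ hx (h1 z hb), map_mul _ _ _⟩
    · rintro _ _ ⟨x, hx, rfl⟩ ⟨z, hz, rfl⟩
      exact ⟨x + z, Ideal.add_mem _ hx hz, map_add _ _ _⟩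

/-- An element of the kernel of `ℤ[F] → ℤ[G]` is congruent to some `r - 1`, `r ∈ R`,
modulo `𝔯𝔣`. -/
theorem exists_sub_mem_relAugIdeal {F G : Type*} [Group F] [Group G] (π : F →* G)
    (hπ : Function.Surjective π) {z : MonoidAlgebra ℤ F}
    (hz : MonoidAlgebra.mapDomainRingHom ℤ π z = 0) :
    ∃ r ∈ π.ker, z - (MonoidAlgebra.of ℤ F r - 1) ∈ relAugIdeal π.ker := by
  have hJ : ∀ r ∈ π.ker, ∀ a, (MonoidAlgebra.of ℤ F r - 1) * (MonoidAlgebra.of ℤ F a - 1) ∈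
      relAugIdeal π.ker := fun r hr a => Ideal.subset_span ⟨r, hr, a, rfl⟩
  -- Closed under addition because rs - 1 = (r - 1) + (s - 1) + (r - 1)(s - 1), whose last term is
  -- in 𝔯𝔣.
  let S : AddSubgroup (MonoidAlgebra ℤ F) :=
    { carrier := {z | ∃ r ∈ π.ker, z - (MonoidAlgebra.of ℤ F r - 1) ∈ relAugIdeal π.ker}
      zero_mem' := ⟨1, one_mem _, by
        rw [map_one, sub_self, sub_self]; exact Ideal.zero_mem _⟩
      add_mem' := by
        rintro x y ⟨r, hr, hx⟩ ⟨s, hs, hy⟩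
        refine ⟨r * s, mul_mem hr hs, ?_⟩
        have h : x + y - (MonoidAlgebra.of ℤ F (r * s) - 1) =
            (x - (MonoidAlgebra.of ℤ F r - 1)) + (y - (MonoidAlgebra.of ℤ F s - 1)) -
              (MonoidAlgebra.of ℤ F r - 1) * (MonoidAlgebra.of ℤ F s - 1) := by
          rw [map_mul]; noncomm_ring
        rw [h]
        exact Ideal.sub_mem _ (Ideal.add_mem _ hx hy) (hJ r hr s)
      neg_mem' := by
        rintro x ⟨r, hr, hx⟩
        refine ⟨r⁻¹, inv_mem hr, ?_⟩
        have h1 : MonoidAlgebra.of ℤ F r⁻¹ * MonoidAlgebra.of ℤ F r = 1 := by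
          rw [← map_mul, inv_mul_cancel, map_one]
        have h : -x - (MonoidAlgebra.of ℤ F r⁻¹ - 1) =
            -(x - (MonoidAlgebra.of ℤ F r - 1)) +
              (MonoidAlgebra.of ℤ F r⁻¹ - 1) * (MonoidAlgebra.of ℤ F r - 1) := by
          rw [sub_mul, mul_sub, h1]; noncomm_ring
        rw [h]
        exact Ideal.add_mem _ ((Ideal.neg_mem_iff _).2 hx) (hJ _ (inv_mem hr) r) }
  let s : G → F := fun g => (hπ g).choose
  have hs : ∀ g, π (s g) = g := fun g => (hπ g).choose_spec
  let σ : MonoidAlgebra ℤ G →ₗ[ℤ] MonoidAlgebra ℤ F := linExt fun g => MonoidAlgebra.of ℤ F (s g)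
  -- With a set-theoretic section s and r = a s(π a)⁻¹ one has a - s(π a) = (r - 1)s(π a), which is
  -- r - 1 modulo 𝔯𝔣.
  have key : ∀ z, z - σ (MonoidAlgebra.mapDomainRingHom ℤ π z) ∈ S := by
    intro z
    induction z using MonoidAlgebra.induction_on with
    | of a =>
      have h : MonoidAlgebra.mapDomainRingHom ℤ π (MonoidAlgebra.of ℤ F a) =
          MonoidAlgebra.of ℤ G (π a) := by simp
      rw [h, linExt_of]
      have hr : a * (s (π a))⁻¹ ∈ π.ker := by
        rw [MonoidHom.mem_ker, map_mul, map_inv, hs, mul_inv_cancel]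
      refine ⟨a * (s (π a))⁻¹, hr, ?_⟩
      convert hJ _ hr (s (π a)) using 1
      rw [sub_mul, mul_sub, ← map_mul, inv_mul_cancel_right]
      noncomm_ring
    | add x y hx hy =>
      rw [map_add, map_add, add_sub_add_comm]
      exact add_mem hx hy
    | smul r x hx =>
      rw [map_zsmul, map_zsmul, ← zsmul_sub]
      exact zsmul_mem hx r
  have h := key z
  rwa [hz, map_zero, sub_zero] at h

/-- Every element of `D₄(G)` lifts to `γ₂(F) ∩ (1 + 𝔯𝔣 + 𝔣⁴)`. -/
theorem exists_lift_mem_relAugIdeal {G : Type u} [Group G] (c : Pres G) {g : G} (hg : g ∈ D 4 G) :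
    ∃ w ∈ γ 2 c.F, c.π w = g ∧
      MonoidAlgebra.of ℤ c.F w - 1 ∈ relAugIdeal c.R ⊔ augIdeal c.F ^ 4 := by
  obtain ⟨w, rfl⟩ := c.surj g
  obtain ⟨y, hy, hyw⟩ := exists_mem_augIdeal_pow c.π c.surj 4 (mem_D.1 hg)
  obtain ⟨r, hr, hz⟩ := exists_sub_mem_relAugIdeal c.π c.surj
    (z := MonoidAlgebra.of ℤ c.F w - 1 - y) (by
      rw [map_sub, hyw, map_sub, map_one]
      simp)
  have h1 : MonoidAlgebra.of ℤ c.F r⁻¹ * MonoidAlgebra.of ℤ c.F r = 1 := by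
    rw [← map_mul, inv_mul_cancel, map_one]
  have h : MonoidAlgebra.of ℤ c.F (r⁻¹ * w) - 1 ∈ relAugIdeal c.R ⊔ augIdeal c.F ^ 4 := by
    -- The bracket sums to w - r; dividing by r alters the lift without changing its image in G.
    have e : MonoidAlgebra.of ℤ c.F (r⁻¹ * w) - 1 = MonoidAlgebra.of ℤ c.F r⁻¹ *
        ((MonoidAlgebra.of ℤ c.F w - 1 - y - (MonoidAlgebra.of ℤ c.F r - 1)) + y) := by
      rw [map_mul, mul_add, mul_sub, mul_sub, mul_sub, mul_sub, h1]; noncomm_ring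
    rw [e]
    exact Ideal.mul_mem_left _ _ (Submodule.add_mem_sup hz hy)
  refine ⟨r⁻¹ * w, D_two_le _ (mem_D.2 ?_), ?_, h⟩
  -- Since 𝔯𝔣 + 𝔣⁴ ⊆ 𝔣², the corrected lift is in D₂(F), hence in γ₂(F).
  · refine (sup_le ?_ (Ideal.pow_le_pow_right (by norm_num)) :
      relAugIdeal c.R ⊔ augIdeal c.F ^ 4 ≤ augIdeal c.F ^ 2) h
    refine Ideal.span_le.2 ?_
    rintro _ ⟨r, _, a, rfl⟩
    refine mul_mem_augIdeal_pow_succ ?_ (of_sub_one_mem_augIdeal a)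
    rw [Submodule.pow_one]
    exact of_sub_one_mem_augIdeal r
  · rw [MonoidHom.mem_ker] at hr
    rw [map_mul, map_inv, hr, inv_one, one_mul]

/-! ### Elements of limits over `Pres(G)` -/

/-- Elements of an abelian group are morphisms from ℤ, so the universal property of the limit
applies to them. -/
theorem limit_elem_ext {𝓕 : AllPres.{u} ⥤ AddCommGrpCat.{u}} {G : GrpCat.{u}}
    {x y : (limPres 𝓕).obj G}
    (h : ∀ c, limit.π (fiber G ⋙ 𝓕) c x = limit.π (fiber G ⋙ 𝓕) c y) : x = y := by
  let hom (z : (limPres 𝓕).obj G) : AddCommGrpCat.of (ULift.{u} ℤ) ⟶ limit (fiber G ⋙ 𝓕) :=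
    AddCommGrpCat.ofHom (uliftZMultiplesHom _ z)
  have hom_one : ∀ z, hom z (ULift.up 1) = z := fun z =>
    (uliftZMultiplesHom ((limPres 𝓕).obj G)).symm_apply_apply z
  have e : hom x = hom y := by
    refine limit.hom_ext fun c => ?_
    ext ⟨n⟩
    exact (map_zsmul (limit.π (fiber G ⋙ 𝓕) c).hom n _).trans
      ((congrArg (n • ·) (h c)).trans (map_zsmul (limit.π (fiber G ⋙ 𝓕) c).hom n _).symm)
  rw [← hom_one x, e, hom_one]

theorem exists_limit_elem {𝓕 : AllPres.{u} ⥤ AddCommGrpCat.{u}} {G : GrpCat.{u}}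
    (s : ∀ c : Pres G, (fiber G ⋙ 𝓕).obj c)
    (hs : ∀ {c c' : Pres G} (f : c ⟶ c'), (fiber G ⋙ 𝓕).map f (s c) = s c') :
    ∃ x : (limPres 𝓕).obj G, ∀ c, limit.π (fiber G ⋙ 𝓕) c x = s c := by
  let S : Cone (fiber G ⋙ 𝓕) :=
    { pt := AddCommGrpCat.of (ULift.{u} ℤ)
      π :=
        { app := fun c => AddCommGrpCat.ofHom (uliftZMultiplesHom _ (s c))
          naturality := fun c c' f => by
            ext ⟨n⟩
            change n • s c' = (fiber G ⋙ 𝓕).map f (n • s c)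
            rw [map_zsmul, hs] } }
  refine ⟨limit.lift _ S (ULift.up 1), fun c => ?_⟩
  refine (ConcreteCategory.comp_apply _ _ _).symm.trans ?_
  rw [limit.lift_π]
  exact one_zsmul _

theorem limit_elem_w {𝓕 : AllPres.{u} ⥤ AddCommGrpCat.{u}} {G : GrpCat.{u}}
    (x : (limPres 𝓕).obj G) {c c' : Pres G} (f : c ⟶ c') :
    (fiber G ⋙ 𝓕).map f (limit.π (fiber G ⋙ 𝓕) c x) = limit.π (fiber G ⋙ 𝓕) c' x :=
  (ConcreteCategory.comp_apply _ _ _).symm.trans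
    (ConcreteCategory.congr_hom (limit.w (fiber G ⋙ 𝓕) f) x)

theorem limPresMap_app_π {𝓕 𝓖 : AllPres.{u} ⥤ AddCommGrpCat.{u}} (α : 𝓕 ⟶ 𝓖) {G : GrpCat.{u}}
    (x : (limPres 𝓕).obj G) (c : Pres G) :
    limit.π (fiber G ⋙ 𝓖) c ((limPresMap α).app G x) =
      α.app ((fiber G).obj c) (limit.π (fiber G ⋙ 𝓕) c x) :=
  (ConcreteCategory.comp_apply _ _ _).symm.trans
    ((ConcreteCategory.congr_hom (limMap_π (Functor.whiskerLeft (fiber G) α) c) x).trans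
      (ConcreteCategory.comp_apply _ _ _))

/-! ### Classes in the functors of the exact sequence -/

theorem subquotMk_eq_iff {E : Type u} [Group E] {A N : Subgroup E} [N.Normal] (h : ⁅A, A⁆ ≤ N)
    {a b : A} : subquotMk A N h a = subquotMk A N h b ↔ (a : E)⁻¹ * b ∈ N :=
  QuotientGroup.eq.trans Subgroup.mem_subgroupOf

theorem subquotMk_mul {E : Type u} [Group E] {A N : Subgroup E} [N.Normal] (h : ⁅A, A⁆ ≤ N)
    (a b : A) : subquotMk A N h (a * b) = subquotMk A N h a + subquotMk A N h b :=
  rfl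

theorem subquotMk_eq_zero_iff {E : Type u} [Group E] {A N : Subgroup E} [N.Normal]
    (h : ⁅A, A⁆ ≤ N) {a : A} : subquotMk A N h a = 0 ↔ (a : E) ∈ N := by
  have h1 : subquotMk A N h 1 = 0 := rfl
  rw [← h1, eq_comm, subquotMk_eq_iff, OneMemClass.coe_one, inv_one, one_mul]

/-- The class in `(R ∩ γ₂(F)) / (γ₂(R)(R ∩ γ₄(F)))` of `w ∈ R ∩ γ₂(F)`. -/
def relClass {G : GrpCat.{u}} (c : Pres G) (w : (c.R ⊓ γ 2 c.F : Subgroup c.F)) :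
    (fiber G ⋙ relQuot).obj c :=
  subquotMk (c.R ⊓ γ 2 c.F) (relDenom c) (relDenom_comm c) w

theorem allClass_eq_iff {G : GrpCat.{u}} (c : Pres G) {v w : γ 2 c.F} :
    allClass c v = allClass c w ↔ (v : c.F)⁻¹ * w ∈ allDenom c :=
  subquotMk_eq_iff (allDenom_comm c)

theorem allClass_surjective {G : GrpCat.{u}} (c : Pres G) : Function.Surjective (allClass c) :=
  subquotMk_surjective _ _ _

theorem relClass_surjective {G : GrpCat.{u}} (c : Pres G) : Function.Surjective (relClass c) :=
  subquotMk_surjective _ _ _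

theorem inclQuot_relClass {G : GrpCat.{u}} (c : Pres G) (w : (c.R ⊓ γ 2 c.F : Subgroup c.F)) :
    inclQuot.app ((fiber G).obj c) (relClass c w) = allClass c ⟨w, w.2.2⟩ :=
  rfl

theorem map_allClass {G : GrpCat.{u}} {c c' : Pres G} (f : c ⟶ c') (w : γ 2 c.F) :
    (fiber G ⋙ allQuot).map f (allClass c w) =
      allClass c' ⟨Pres.Hom.hom f w, map_γ_le 2 (Pres.Hom.hom f) w.2⟩ :=
  rfl

/-- The factor [R, R] dies in G, so the class of `w` determines `π w` modulo γ₄(G). -/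
theorem allDenom_le_comap_π {G : Type u} [Group G] (c : Pres G) :
    allDenom c ≤ (γ 4 G).comap c.π := by
  refine sup_le ?_ (map_γ_le 4 c.π)
  refine (Subgroup.commutator_le_left c.R c.R).trans fun r hr => ?_
  rw [Subgroup.mem_comap, show c.π r = 1 from hr]
  exact one_mem _

/-- `γ₂(R)γ₄(F) ∩ R = γ₂(R)(R ∩ γ₄(F))`. -/
theorem allDenom_inf_R_le {G : Type u} [Group G] (c : Pres G) : allDenom c ⊓ c.R ≤ relDenom c := by
  rintro x ⟨hx, hxR⟩
  obtain ⟨y, hy, z, hz, rfl⟩ := Subgroup.mem_sup_of_normal_left.1 hx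
  have hyR : y ∈ c.R := Subgroup.commutator_le_left c.R c.R hy
  -- Modular law: [R, R] ⊆ R, so the γ₄-factor of an element of R is itself in R.
  exact Subgroup.mul_mem_sup hy ⟨(Subgroup.mul_mem_cancel_left _ hyR).1 hxR, hz⟩

theorem γ_four_le_D (G : Type u) [Group G] : γ 4 G ≤ D 4 G :=
  lowerCentralSeries_le_D 3

/-- Holds at every single presentation, by the modular law; it serves both for injectivity on limits
and for gluing preimages. -/
theorem inclQuot_app_injective {G : GrpCat.{u}} (c : Pres G) :
    Function.Injective (inclQuot.app ((fiber G).obj c)) := by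
  intro x y h
  obtain ⟨v, rfl⟩ := relClass_surjective c x
  obtain ⟨w, rfl⟩ := relClass_surjective c y
  rw [inclQuot_relClass, inclQuot_relClass, allClass_eq_iff] at h
  exact (subquotMk_eq_iff (relDenom_comm c)).2
    (allDenom_inf_R_le c ⟨h, c.R.mul_mem (c.R.inv_mem v.2.1) w.2.1⟩)

/-- The class of `w ∈ γ₂(F)` comes from `R ∩ γ₂(F)` if `w` has image in `γ₄(G)`. -/
theorem allClass_mem_range_inclQuot {G : GrpCat.{u}} (c : Pres G) (w : γ 2 c.F)
    (hw : c.π w ∈ γ 4 G) : ∃ y, inclQuot.app ((fiber G).obj c) y = allClass c w := by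
  have hmap : (γ 4 c.F).map c.π = γ 4 G :=
    (Subgroup.map_lowerCentralSeries ⊤ c.π 3).trans (by
      rw [Subgroup.map_top_of_surjective c.π c.surj]; rfl)
  -- Choose v ∈ γ₄(F) over the image of `w`; then wv⁻¹ is in R and represents the same class as `w`.
  rw [← hmap] at hw
  obtain ⟨v, hv, hvw⟩ := hw
  have h24 : γ 4 c.F ≤ γ 2 c.F :=
    (Subgroup.lowerCentralSeries_antitone (S := (⊤ : Subgroup c.F))) (show 1 ≤ 3 by norm_num)
  have hR : (w : c.F) * v⁻¹ ∈ c.R := by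
    change c.π _ = 1
    rw [map_mul, map_inv, hvw, mul_inv_cancel]
  refine ⟨relClass c ⟨w * v⁻¹, hR, (γ 2 c.F).mul_mem w.2 ((γ 2 c.F).inv_mem (h24 hv))⟩, ?_⟩
  rw [inclQuot_relClass, allClass_eq_iff]
  refine (le_sup_right : γ 4 c.F ≤ allDenom c) ?_
  simpa using hv

/-! ### The natural map to D₄(G)/γ₄(G) -/

/-- The morphism from the standard presentation of `G` to any other. -/
noncomputable def fromStd {G : GrpCat.{u}} (c : Pres G) : stdPres G PUnit.{u + 1} ⟶ c :=
  Pres.Hom.mk (liftHom ⟨G, c⟩ (MonoidHom.id _)).hom (liftHom ⟨G, c⟩ (MonoidHom.id _)).comm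

theorem exists_std_rep {G : GrpCat.{u}} (x : (limPres allQuot).obj G) :
    ∃ w, limit.π (fiber G ⋙ allQuot) (stdPres G PUnit.{u + 1}) x = allClass _ w :=
  let ⟨w, hw⟩ := allClass_surjective _ (limit.π (fiber G ⋙ allQuot) (stdPres G PUnit.{u + 1}) x)
  ⟨w, hw.symm⟩

theorem π_inv_mul_π_mem {G : GrpCat.{u}} {x : (limPres allQuot).obj G} {c c' : Pres G}
    (f : c ⟶ c') {v : γ 2 c.F} {w : γ 2 c'.F}
    (hv : limit.π (fiber G ⋙ allQuot) c x = allClass c v)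
    (hw : limit.π (fiber G ⋙ allQuot) c' x = allClass c' w) : (c.π v)⁻¹ * c'.π w ∈ γ 4 G := by
  have h := limit_elem_w x f
  rw [hv, hw, map_allClass, allClass_eq_iff] at h
  have h' := allDenom_le_comap_π c' h
  rwa [Subgroup.mem_comap, map_mul, map_inv, Pres.Hom.π_apply] at h'

/-- If `w ∈ γ₂(F)` represents a component of an element of the limit, then its image in `G` is in
the fourth dimension subgroup. -/
theorem π_mem_D_four {G : GrpCat.{u}} {x : (limPres allQuot).obj G} {c : Pres G} {w : γ 2 c.F}
    (hw : limit.π (fiber G ⋙ allQuot) c x = allClass c w) : c.π w ∈ D 4 G := by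
  obtain ⟨v, hv⟩ := exists_std_rep x
  have hD : (stdPres G PUnit.{u + 1}).π v ∈ D 4 G := by
    refine mem_D_four_of_dupHom G v ?_
    have h0 := limit_elem_w x (dupHom G false)
    have h1 := limit_elem_w x (dupHom G true)
    rw [hv, map_allClass] at h0 h1
    exact (allClass_eq_iff _).1 (h0.trans h1.symm)
  have h := mul_mem hD (γ_four_le_D G (π_inv_mul_π_mem (fromStd c) hv hw))
  rwa [mul_inv_cancel_left] at h

/-- The homomorphism from the limit to the dimension quotient, on elements. -/
noncomputable def toDimQuot {G : GrpCat.{u}} (x : (limPres allQuot).obj G) : dimQuot.obj G :=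
  dimClass G ⟨_, π_mem_D_four (exists_std_rep x).choose_spec⟩

/-- Independence of the presentation and of the representative; additivity and naturality follow by
picking convenient representatives. -/
theorem toDimQuot_eq {G : GrpCat.{u}} {x : (limPres allQuot).obj G} {c : Pres G} {w : γ 2 c.F}
    (hw : limit.π (fiber G ⋙ allQuot) c x = allClass c w) :
    toDimQuot x = dimClass G ⟨c.π w, π_mem_D_four hw⟩ :=
  (subquotMk_eq_iff (D_four_comm G)).2
    (π_inv_mul_π_mem (fromStd c) (exists_std_rep x).choose_spec hw)

/-- The homomorphism from the limit to the dimension quotient. -/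
noncomputable def toDimQuotHom (G : GrpCat.{u}) : (limPres allQuot).obj G →+ dimQuot.obj G where
  toFun := toDimQuot
  map_zero' := by
    have h : limit.π (fiber G ⋙ allQuot) (stdPres G PUnit.{u + 1}) (0 : (limPres allQuot).obj G) =
        allClass _ 1 := map_zero (limit.π (fiber G ⋙ allQuot) (stdPres G PUnit.{u + 1})).hom
    rw [toDimQuot_eq h]
    exact congrArg (dimClass G) (Subtype.ext (map_one _))
  map_add' x y := by
    obtain ⟨v, hv⟩ := exists_std_rep x
    obtain ⟨w, hw⟩ := exists_std_rep y
    have h : limit.π (fiber G ⋙ allQuot) (stdPres G PUnit.{u + 1}) (x + y) =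
        allClass _ (v * w) := by
      refine (map_add (limit.π (fiber G ⋙ allQuot) (stdPres G PUnit.{u + 1})).hom _ _).trans ?_
      exact congrArg₂ (· + ·) hv hw
    rw [toDimQuot_eq hv, toDimQuot_eq hw, toDimQuot_eq h]
    refine Eq.trans ?_ (subquotMk_mul (D_four_comm G) _ _)
    exact congrArg (dimClass G) (Subtype.ext (map_mul _ _ _))

/-- The natural transformation from the limit to the dimension quotient. -/
noncomputable def limToDimQuot : limPres allQuot.{u} ⟶ dimQuot.{u} where
  app G := ConcreteCategory.ofHom (toDimQuotHom G)
  naturality G G' h := by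
    ext x
    obtain ⟨w, hw⟩ := exists_std_rep x
    let φ : (fiber G).obj (stdPres G PUnit.{u + 1}) ⟶ (fiber G').obj (stdPres G' PUnit.{u + 1}) :=
      liftHom ⟨G', stdPres G' PUnit.{u + 1}⟩ h.hom
    have e : limit.π (fiber G' ⋙ allQuot) (stdPres G' PUnit.{u + 1}) ((limPres allQuot).map h x) =
        allClass _ ⟨AllPres.Hom.hom φ w, map_γ_le 2 (AllPres.Hom.hom φ) w.2⟩ := by
      refine ((ConcreteCategory.comp_apply _ _ _).symm.trans (ConcreteCategory.congr_hom
        (limPresHom_π allQuot h _ _ φ rfl) x)).trans ((ConcreteCategory.comp_apply _ _ _).trans ?_)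
      rw [hw]
      rfl
    change toDimQuot ((limPres allQuot).map h x) = dimQuot.map h (toDimQuot x)
    rw [toDimQuot_eq e, toDimQuot_eq hw]
    exact congrArg (dimClass G') (Subtype.ext 
      (DFunLike.congr_fun (AllPres.Hom.comm φ) (w : (stdPres G PUnit.{u + 1}).F)))

theorem limToDimQuot_app_apply {G : GrpCat.{u}} (x : (limPres allQuot).obj G) :
    limToDimQuot.app G x = toDimQuot x :=
  rfl

/-! ### Exactness -/

theorem limPresMap_inclQuot_injective (G : GrpCat.{u}) :
    Function.Injective ((limPresMap inclQuot).app G) := by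
  intro x y h
  refine limit_elem_ext fun c => inclQuot_app_injective c ?_
  rw [← limPresMap_app_π, h, limPresMap_app_π]

theorem limToDimQuot_exact (G : GrpCat.{u}) :
    Function.Exact ((limPresMap inclQuot).app G) (limToDimQuot.app G) := by
  intro x
  rw [limToDimQuot_app_apply]
  constructor
  · intro hx
    have hex : ∀ c : Pres G, ∃ y, inclQuot.app ((fiber G).obj c) y =
        limit.π (fiber G ⋙ allQuot) c x := by
      intro c
      obtain ⟨w, hw⟩ := allClass_surjective c (limit.π (fiber G ⋙ allQuot) c x)
      rw [toDimQuot_eq hw.symm] at hx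
      rw [← hw]
      exact allClass_mem_range_inclQuot c w ((subquotMk_eq_zero_iff (D_four_comm G)).1 hx)
    choose s hs using hex
    -- The preimages are chosen separately at each presentation, but they are unique, hence
    -- compatible.
    obtain ⟨y, hy⟩ := exists_limit_elem (𝓕 := relQuot) s fun {c c'} f => by
      refine inclQuot_app_injective c' ?_
      rw [hs, ← limit_elem_w x f, ← hs]
      exact ConcreteCategory.congr_hom (inclQuot.naturality ((fiber G).map f)) (s c)
    refine ⟨y, limit_elem_ext fun c => ?_⟩
    rw [limPresMap_app_π, hy, hs]
  · rintro ⟨y, rfl⟩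
    obtain ⟨w, hw⟩ := relClass_surjective _
      (limit.π (fiber G ⋙ relQuot) (stdPres G PUnit.{u + 1}) y)
    have h := limPresMap_app_π inclQuot y (stdPres G PUnit.{u + 1})
    rw [← hw, inclQuot_relClass] at h
    rw [toDimQuot_eq h]
    refine (subquotMk_eq_zero_iff (D_four_comm G)).2 ?_
    have h1 : (stdPres G PUnit.{u + 1}).π (w : (stdPres G PUnit.{u + 1}).F) = 1 := w.2.1
    change (stdPres G PUnit.{u + 1}).π (w : (stdPres G PUnit.{u + 1}).F) ∈ γ 4 G
    rw [h1]
    exact one_mem _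

theorem limToDimQuot_surjective (G : GrpCat.{u}) : Function.Surjective (limToDimQuot.app G) := by
  intro z
  obtain ⟨⟨g, hg⟩, rfl⟩ := subquotMk_surjective _ _ (D_four_comm G) z
  obtain ⟨w, hw2, hwg, hw⟩ := exists_lift_mem_relAugIdeal (stdPres G PUnit.{u + 1}) hg
  -- Push one good lift from the standard presentation to all others; since any two morphisms agree
  -- on it modulo the denominator, the arbitrary choices in `fromStd` do not matter.
  obtain ⟨x, hx⟩ := exists_limit_elem (𝓕 := allQuot)
    (fun c => allClass c ⟨(fromStd c).hom w, map_γ_le 2 (fromStd c).hom hw2⟩)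
    fun {c c'} f => (allClass_eq_iff c').2 (inv_mul_mem_allDenom (fromStd c ≫ f) (fromStd c') hw)
  refine ⟨x, ?_⟩
  rw [limToDimQuot_app_apply, toDimQuot_eq (hx (stdPres G PUnit.{u + 1}))]
  exact congrArg (dimClass G) (Subtype.ext ((Pres.Hom.π_apply (fromStd _) w).trans hwg))

end PresLim

open PresLim
theorem theorem6p1 :
    ∃ p : limPres allQuot.{u} ⟶ dimQuot.{u},
      (∀ G : GrpCat.{u},
        Function.Injective ((limPresMap inclQuot).app G) ∧
        Function.Exact ((limPresMap inclQuot).app G) (p.app G) ∧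
        Function.Surjective (p.app G)) ∧
      (∀ (G : GrpCat.{u}) (x : (limPres allQuot).obj G) (c : Pres G) (w : γ 2 c.F),
        limit.π (fiber G ⋙ allQuot) c x = allClass c w →
          ∃ hg : c.π w ∈ D 4 G, p.app G x = dimClass G ⟨c.π w, hg⟩) :=
  ⟨limToDimQuot, fun G => ⟨limPresMap_inclQuot_injective G, limToDimQuot_exact G,
    limToDimQuot_surjective G⟩, fun _ _ _ _ hw => ⟨π_mem_D_four hw, toDimQuot_eq hw⟩⟩
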